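/- \textbf{Definitions.} An \emph{asymptotic couple} is a pair $(\Gamma,\psi)$ where $\Gamma$ is a (totally) ordered abelian group and $\psi:\Gamma\setminus\{0\}\to\Gamma$ satisfies, for all nonzero $\alpha,\beta\in\Gamma$: (AC1) if $\alpha+\beta\neq 0$ then $\psi(\alpha+\beta)\ge\min(\psi(\alpha),\psi(\beta))$; (AC2) $\psi(r\alpha)=\psi(\alpha)$ for all nonzero integers $r$; (AC3) if $\alpha>0$ then $\alpha+\psi(\alpha)>\psi(\beta)$. It is of \emph{$H$-type} if $0<\alpha\le\beta$ implies $\psi(\alpha)\ge\psi(\beta)$. Put $\Psi:=\psi(\Gamma\setminus\{0\})$, and for a subset $S$ of $\Gamma$ put $S_\infty:=S\cup\{\infty\}$, ordered so that $S<\infty$. The couple has \emph{asymptotic integration} if every $\alpha\in\Gamma$ is of the form $\beta+\psi(\beta)$ with $\beta\neq 0$; for couples of $H$-type this $\beta$ is unique, it is denoted by $\int\alpha$, and we set $s\alpha:=\psi(\int\alpha)\in\Psi$. A \emph{model of $T_{\log}$} is an asymptotic couple $(\Gamma,\psi)$ of $H$-type with asymptotic integration, with $\Gamma$ divisible (and hence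 a $\mathbb{Q}$-vector space), such that $\Psi$ has least element $s0$ and $s0>0$, each $\alpha\in\Psi$ has $s\alpha$ as immediate successor in $\Psi$, and $s$ restricts to a bijection $\Psi\to\Psi^{>s0}:=\{x\in\Psi: x>s0\}$. Let $p:\Psi^{>s0}\to\Psi$ be the inverse of this bijection, extended by $p(\alpha):=\infty$ for all $\alpha\in\Gamma_\infty\setminus\Psi^{>s0}$. We regard $(\Gamma,\psi)$ as a first-order structure with underlying set $\Gamma_\infty$ in the language $L=\{0,+,-,<,\psi,\infty,s,p,\delta_1,\delta_2,\dots\}$, where $\delta_n$ is division by $n$ and $\infty$ is the default value: $-\infty=\gamma+\infty=\infty+\gamma=\infty+\infty=\psi(0)=\psi(\infty)=s(\infty)=\delta_n(\infty)=\infty$ for all $\gamma\in\Gamma$ and $n\ge1$. A function $F:\Psi\to\Gamma_\infty$ is \emph{definable} if its graph is a subset of $(\Gamma_\infty)^2$ definable by an $L$-formula with parameters from $\Gamma_\infty$. For $x\in\Psi$ and $k\in\mathbb{Z}$, let $s^k(x)\in\Psi_\infty$ be the $k$-fold iterate of $s$ if $k\ge0$ (so $s^0(x)=x$), and $s^k(x):=p^{-k}(x)$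 if $k<0$. A function $F:\Psi\to\Gamma_\infty$ is an \emph{$s$-function} if it is constant (with value in $\Gamma_\infty$), or there are $n\ge1$, integers $k_1<\dots<k_n$, nonzero rationals $q_1,\dots,q_n$ and $\beta\in\Gamma$ such that $F(x)=\sum_{j=1}^n q_j s^{k_j}(x)-\beta$ for all $x\in\Psi$; here the right-hand side is $\infty$ if some $s^{k_j}(x)=\infty$. \textbf{Theorem.} Let $(\Gamma,\psi)$ be a model of $T_{\log}$ and let $F:\Psi\to\Gamma_\infty$ be a definable function. Then there are $n\ge 1$ and $s0=\alpha_0<\alpha_1<\dots<\alpha_{n-1}<\alpha_n=\infty$ in $\Psi_\infty$ such that, for $k=0,\dots,n-1$, the restriction of $F$ to $[\alpha_k,\alpha_{k+1})_\Psi:=\{x\in\Psi:\alpha_k\le x<\alpha_{k+1}\}$ is equal to the restriction of an $s$-function. -/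

import Mathlib

/-- An asymptotic couple on the ordered abelian group `Γ`. The map `ψ : Γ ∖ {0} → Γ` is extended by
`ψ 0 = ∞` and hence takes values in `Γ_∞ = WithTop Γ`; it is finite exactly off `0`. -/
class AsymptoticCouple (Γ : Type*) [AddCommGroup Γ] [LinearOrder Γ] [IsOrderedAddMonoid Γ] where
  /-- The map `ψ`. -/
  psi : Γ → WithTop Γ
  psi_eq_top_iff : ∀ α : Γ, psi α = ⊤ ↔ α = 0
  ac1 : ∀ α β : Γ, α ≠ 0 → β ≠ 0 → α + β ≠ 0 → min (psi α) (psi β) ≤ psi (α + β)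
  ac2 : ∀ (r : ℤ) (α : Γ), r ≠ 0 → α ≠ 0 → psi (r • α) = psi α
  ac3 : ∀ α β : Γ, 0 < α → β ≠ 0 → psi β < (α : WithTop Γ) + psi α

namespace AsymptoticCouple

section Basic

variable (Γ : Type*) [AddCommGroup Γ] [LinearOrder Γ] [IsOrderedAddMonoid Γ] [AsymptoticCouple Γ]

/-- The couple is of `H`-type. -/
def IsHType : Prop :=
  ∀ α β : Γ, 0 < α → α ≤ β → psi β ≤ psi α

/-- Asymptotic integration: every `α` is of the form `β' = β + ψ β` with `β ≠ 0`. -/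
def HasAsymptoticIntegration : Prop :=
  ∀ α : Γ, ∃ β : Γ, β ≠ 0 ∧ (β : WithTop Γ) + psi β = α

/-- The set `Ψ = ψ(Γ ∖ {0})`, viewed as a subset of `Γ_∞`; it does not contain `∞`. -/
def Psi : Set (WithTop Γ) :=
  {x | ∃ γ : Γ, γ ≠ 0 ∧ psi γ = x}

variable {Γ}

/-- `ψ` extended to `Γ_∞` by `ψ ∞ = ∞`. -/
def psiInf : WithTop Γ → WithTop Γ
  | ⊤ => ⊤
  | (γ : Γ) => psi γ

open Classical in
/-- The integral `∫ α`: the element `β ≠ 0` with `β + ψ β = α` (set to `0` if there is none). -/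
noncomputable def integral (α : Γ) : Γ :=
  if h : ∃ β : Γ, β ≠ 0 ∧ (β : WithTop Γ) + psi β = α then h.choose else 0

/-- The successor function `s α = ψ (∫ α)`, extended to `Γ_∞` by `s ∞ = ∞`. -/
noncomputable def succ : WithTop Γ → WithTop Γ
  | ⊤ => ⊤
  | (α : Γ) => psi (integral α)

variable (Γ) in
/-- The set `Ψ^{> s0}`. -/
def PsiGt : Set (WithTop Γ) :=
  {x | x ∈ Psi Γ ∧ succ ((0 : Γ) : WithTop Γ) < x}

open Classical in
/-- The function `p`: on `Ψ^{> s0}` the inverse of `s : Ψ → Ψ^{> s0}`, and `∞` elsewhere. -/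
noncomputable def pred (a : WithTop Γ) : WithTop Γ :=
  if h : a ∈ PsiGt Γ ∧ ∃ x ∈ Psi Γ, succ x = a then h.2.choose else ⊤

/-- `s^k` for `k ∈ ℤ`, where `s^k = p^{-k}` for `k < 0`. -/
noncomputable def succPow : ℤ → WithTop Γ → WithTop Γ
  | Int.ofNat m => succ^[m]
  | Int.negSucc m => pred^[m + 1]

end Basic

/-- Function symbols of the language `L`: `0, ∞` (constants), `+` (binary), and the unary symbols
`-`, `ψ`, `s`, `p`, and `δ_n` for `n ≥ 1`. -/
inductive LFunctions : ℕ → Type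
  | zero : LFunctions 0
  | infty : LFunctions 0
  | add : LFunctions 2
  | neg : LFunctions 1
  | psi : LFunctions 1
  | succ : LFunctions 1
  | pred : LFunctions 1
  | delta (n : ℕ+) : LFunctions 1

/-- The only relation symbol of `L` is the binary symbol `<`. -/
inductive LRelations : ℕ → Type
  | lt : LRelations 2

/-- The language `L = {0, +, -, <, ψ, ∞, s, p, δ_1, δ_2, …}`. -/
def L : FirstOrder.Language := ⟨LFunctions, LRelations⟩

section Model

variable (Γ : Type*) [AddCommGroup Γ] [LinearOrder Γ] [IsOrderedAddMonoid Γ] [Module ℚ Γ]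
  [AsymptoticCouple Γ]

/-- The `L`-structure with underlying set `Γ_∞`, with `∞` as default value; `δ_n` is division
by `n`. -/
noncomputable instance instLStructure : L.Structure (WithTop Γ) where
  funMap {_} f := match f with
    | LFunctions.zero => fun _ => ((0 : Γ) : WithTop Γ)
    | LFunctions.infty => fun _ => ⊤
    | LFunctions.add => fun v => v 0 + v 1
    | LFunctions.neg => fun v => (v 0).map (fun γ : Γ => -γ)
    | LFunctions.psi => fun v => psiInf (v 0)
    | LFunctions.succ => fun v => succ (v 0)
    | LFunctions.pred => fun v => pred (v 0)
    | LFunctions.delta n => fun v => (v 0).map (fun γ : Γ => ((n : ℕ) : ℚ)⁻¹ • γ)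
  RelMap {_} r := match r with
    | LRelations.lt => fun v => v 0 < v 1

/-- `(Γ, ψ)` is a model of `T_log`. Divisibility of `Γ` is expressed by the (unique) structure of a
`ℚ`-vector space on `Γ`. -/
structure IsModelTlog : Prop where
  hType : IsHType Γ
  asymptoticIntegration : HasAsymptoticIntegration Γ
  /-- `Ψ` has least element `s0`, and `s0 > 0`. -/
  isLeast_succ_zero : IsLeast (Psi Γ) (succ ((0 : Γ) : WithTop Γ))
  succ_zero_pos : ((0 : Γ) : WithTop Γ) < succ ((0 : Γ) : WithTop Γ)
  /-- `s α` is the immediate successor of `α` in `Ψ`. -/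
  isLeast_succ : ∀ α ∈ Psi Γ, IsLeast {z | z ∈ Psi Γ ∧ α < z} (succ α)
  /-- `s` restricts to a bijection `Ψ → Ψ^{> s0}`. -/
  bijOn_succ : Set.BijOn succ (Psi Γ) (PsiGt Γ)

variable {Γ}

/-- `F : Ψ → Γ_∞` is definable with parameters: its graph is a definable subset of `(Γ_∞)²`. -/
def IsDefinable (F : Psi Γ → WithTop Γ) : Prop :=
  (Set.univ : Set (WithTop Γ)).Definable L
    {v : Fin 2 → WithTop Γ | ∃ x : Psi Γ, v 0 = x ∧ v 1 = F x}

/-- `F : Ψ → Γ_∞` is an `s`-function: it is constant (possibly `∞`), or of the form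
`x ↦ ∑_j q_j s^{k_j}(x) - β` with at least one term, `k_1 < k_2 < …` in `ℤ`, nonzero rational `q_j`
and `β ∈ Γ`, where `q_j ∞ = ∞`. -/
def IsSFunction (F : Psi Γ → WithTop Γ) : Prop :=
  (∃ c : WithTop Γ, ∀ x, F x = c) ∨
  ∃ (n : ℕ) (k : Fin n → ℤ) (q : Fin n → ℚ) (β : Γ),
    1 ≤ n ∧ StrictMono k ∧ (∀ j, q j ≠ 0) ∧
    ∀ x, F x = (∑ j, (succPow (k j) (x : WithTop Γ)).map (fun γ : Γ => q j • γ))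
      + ((-β : Γ) : WithTop Γ)

end Model

end AsymptoticCouple

open Filter

set_option linter.unusedSectionVars false

/-! The proof determines the definable closure of a point of `Ψ` in a saturated extension and then
concludes by compactness.

A formula defining `F` has finitely many parameters, and these lie in `A ∪ {∞}` for a countable
`ℚ`-subspace `A` closed under `ψ`, `s` and `p` (`exists_isClosed`). Pass to the ultrapower of `Γ`
over a nonprincipal ultrafilter on `ℕ`, which is countably saturated (`germ_isSaturated`). There
every isomorphism between countable closed subspaces extends to any larger countable closed domain,
and the new values can be kept off a prescribed countable subspace (`PIso.exists_extension`). This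
back-and-forth makes the truth of formulas invariant under such isomorphisms
(`realize_iff_of_seqRel`).

Let `u` be a point of `Ψ` in the ultrapower. If `u ∉ A`, the elements `s^k(u)`, `k ∈ ℤ`, are
linearly independent over `A`, and the value and sign of `a + ∑ q_k s^k(u)` depend only on `a`, `q`
and the cut of `u` in `A ∩ Ψ` (`v_add_comb`). Two consequences follow. The span of `A` and all
`s^k(u)` is closed, and since an element outside it can be moved by an isomorphism fixing it, `F(u)`
is `∞` or lies in this span: `F(u) = a + ∑ q_k s^k(u)` (`TransfersOver.mem`,
`TransfersOver.eventually_eq`). Moreover two points with the same cut in `A ∩ Ψ` are conjugate over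
`A` (`exists_pIso_of_cut`), so the same expression computes `F` at both.

There are only countably many candidate expressions and countably many cut points in `A ∩ Ψ`. If no
finite set of cut points divided `Ψ` into cells on each of which one candidate is correct, a
sequence of bad cells would give a point of the ultrapower and a conjugate of it contradicting the
preceding paragraph (`TransfersOver.exists_finite`). -/

theorem rat_smul_pos {V : Type*} [AddCommGroup V] [LinearOrder V] [IsOrderedAddMonoid V]
    [Module ℚ V] {q : ℚ} {a : V} (hq : 0 < q) (ha : 0 < a) : 0 < q • a := by
  have hnum : 0 < q.num := Rat.num_pos.mpr hq
  have h1 : (q.den : ℤ) • (q • a) = q.num • a := by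
    rw [← Int.cast_smul_eq_zsmul ℚ, ← Int.cast_smul_eq_zsmul ℚ, smul_smul]
    congr 1
    push_cast
    exact Rat.den_mul_eq_num q
  have h2 : 0 < (q.den : ℤ) • (q • a) := h1 ▸ zsmul_pos ha hnum
  by_contra h
  have h3 : (q.den : ℤ) • (q • a) ≤ 0 := by
    rw [natCast_zsmul]
    exact nsmul_nonpos (not_lt.mp h) _
  exact absurd h2 (not_lt.mpr h3)

theorem rat_smul_pos_iff {V : Type*} [AddCommGroup V] [LinearOrder V] [IsOrderedAddMonoid V]
    [Module ℚ V] {q : ℚ} {a : V} (hq : 0 < q) : 0 < q • a ↔ 0 < a := by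
  refine ⟨fun h => ?_, rat_smul_pos hq⟩
  have := rat_smul_pos (inv_pos.mpr hq) h
  rwa [inv_smul_smul₀ hq.ne'] at this

/-! ### The finite part of a model, and its valuation `ψ`. -/

/-- The first-order data of a model of `T_log`, with total functions: `psi 0 = 0` and `p x = 0`
for `x` outside `Ψ^{> s0}`. -/
structure LogCouple (V : Type*) [AddCommGroup V] [LinearOrder V] [IsOrderedAddMonoid V]
    [Module ℚ V] where
  Psi : Set V
  psi : V → V
  s : V → V
  p : V → V
  psi_zero : psi 0 = 0
  psi_mem : ∀ a, a ≠ 0 → psi a ∈ Psi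
  psi_add : ∀ a b x, a ≠ 0 → b ≠ 0 → a + b ≠ 0 → x ≤ psi a → x ≤ psi b → x ≤ psi (a + b)
  psi_smul : ∀ (q : ℚ) a, q ≠ 0 → psi (q • a) = psi a
  psi_anti : ∀ a b, 0 < a → a ≤ b → psi b ≤ psi a
  s_mem : ∀ a, s a ∈ Psi
  ne_s : ∀ a, a ≠ s a
  psi_sub_s : ∀ a, psi (a - s a) = s a
  s_zero_le : ∀ x ∈ Psi, s 0 ≤ x
  s_zero_pos : 0 < s 0
  lt_s : ∀ x ∈ Psi, x < s x
  s_le : ∀ x ∈ Psi, ∀ y ∈ Psi, x < y → s x ≤ y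
  p_mem : ∀ x ∈ Psi, x ≠ s 0 → p x ∈ Psi
  s_p : ∀ x ∈ Psi, x ≠ s 0 → s (p x) = x
  p_zero : ∀ x, (x ∉ Psi ∨ x = s 0) → p x = 0
  psi_sub : ∀ x ∈ Psi, ∀ y ∈ Psi, x < y → psi (y - x) = s x

namespace LogCouple

variable {V : Type*} [AddCommGroup V] [LinearOrder V] [IsOrderedAddMonoid V] [Module ℚ V]
  (c : LogCouple V)

open Classical in
/-- The valuation `ψ` with `v 0 = ∞`. -/
noncomputable def v (a : V) : WithTop V := if a = 0 then ⊤ else (c.psi a : V)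

theorem v_zero : c.v 0 = ⊤ := by simp [v]

theorem v_of_ne {a : V} (h : a ≠ 0) : c.v a = (c.psi a : V) := by simp [v, h]

theorem v_eq_coe {a x : V} : c.v a = (x : WithTop V) ↔ a ≠ 0 ∧ c.psi a = x := by
  by_cases h : a = 0 <;> simp [v, h]

theorem psi_neg (a : V) : c.psi (-a) = c.psi a := by
  have := c.psi_smul (-1) a (by norm_num)
  simpa using this

theorem v_smul {q : ℚ} (hq : q ≠ 0) (a : V) : c.v (q • a) = c.v a := by
  by_cases h : a = 0
  · simp [h]
  · rw [c.v_of_ne h, c.v_of_ne (smul_ne_zero hq h), c.psi_smul q a hq]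

theorem v_neg (a : V) : c.v (-a) = c.v a := by
  have := c.v_smul (q := -1) (by norm_num) a
  simpa using this

theorem v_sub_comm (a b : V) : c.v (a - b) = c.v (b - a) := by
  rw [← c.v_neg, neg_sub]

theorem v_add {a b : V} {x : WithTop V} (ha : x ≤ c.v a) (hb : x ≤ c.v b) : x ≤ c.v (a + b) := by
  by_cases h0 : a = 0
  · simpa [h0] using hb
  by_cases h1 : b = 0
  · simpa [h1] using ha
  by_cases h2 : a + b = 0
  · simp [h2, c.v_zero]
  rw [c.v_of_ne h0] at ha
  rw [c.v_of_ne h1] at hb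
  rw [c.v_of_ne h2]
  obtain ⟨y, rfl⟩ := WithTop.ne_top_iff_exists.mp (ne_top_of_le_ne_top (WithTop.coe_ne_top) ha)
  simp only [WithTop.coe_le_coe] at *
  exact c.psi_add a b y h0 h1 h2 ha hb

theorem v_sub {a b : V} {x : WithTop V} (ha : x ≤ c.v a) (hb : x ≤ c.v b) : x ≤ c.v (a - b) := by
  rw [sub_eq_add_neg]
  exact c.v_add ha (by rwa [c.v_neg])

theorem lt_v_add {a b : V} {x : WithTop V} (ha : x < c.v a) (hb : x < c.v b) : x < c.v (a + b) :=
  (lt_min ha hb).trans_le (c.v_add (min_le_left _ _) (min_le_right _ _))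

theorem v_add_of_lt {a b : V} (h : c.v a < c.v b) : c.v (a + b) = c.v a := by
  refine le_antisymm ?_ (c.v_add le_rfl h.le)
  by_contra h'
  rw [not_le] at h'
  have := c.lt_v_add h' (b := -b) (by rwa [c.v_neg])
  simp at this

theorem v_sub_of_lt {a b : V} (h : c.v a < c.v b) : c.v (a - b) = c.v a := by
  rw [sub_eq_add_neg, c.v_add_of_lt (by rwa [c.v_neg])]

theorem v_anti {a b : V} (ha : 0 ≤ a) (h : a ≤ b) : c.v b ≤ c.v a := by
  rcases ha.eq_or_lt with rfl | ha
  · simp [c.v_zero]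
  · rw [c.v_of_ne ha.ne', c.v_of_ne (ha.trans_le h).ne']
    exact_mod_cast c.psi_anti a b ha h

/-- By the `H`-type condition an element of larger value is smaller in absolute value, so the
summand of least value decides the sign. -/
theorem pos_add_of_lt {a b : V} (h : c.v a < c.v b) (ha : 0 < a) : 0 < a + b := by
  by_contra h'
  have h1 : a ≤ -b := by
    rwa [not_lt, ← sub_neg_eq_add, sub_nonpos] at h'
  have := c.v_anti ha.le h1
  rw [c.v_neg] at this
  exact absurd h (not_lt.mpr this)

theorem pos_add_iff_of_lt {a b : V} (h : c.v a < c.v b) : 0 < a + b ↔ 0 < a := by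
  refine ⟨fun hab => ?_, c.pos_add_of_lt h⟩
  have := c.pos_add_of_lt (a := a + b) (b := -b)
    (by rw [c.v_add_of_lt h, c.v_neg]; exact h) hab
  simpa using this

theorem lt_v_sum {ι : Type*} (t : Finset ι) (f : ι → V) {x : V}
    (h : ∀ i ∈ t, (x : WithTop V) < c.v (f i)) : (x : WithTop V) < c.v (∑ i ∈ t, f i) := by
  classical
  induction t using Finset.induction_on with
  | empty => simp [c.v_zero]
  | insert i t hi ih =>
    rw [Finset.sum_insert hi]
    exact c.lt_v_add (h i (Finset.mem_insert_self _ _))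
      (ih fun j hj => h j (Finset.mem_insert_of_mem hj))

theorem v_sub_s (a : V) : c.v (a - c.s a) = (c.s a : V) := by
  rw [c.v_of_ne (sub_ne_zero.mpr (c.ne_s a)), c.psi_sub_s]

theorem v_sub_Psi {x y : V} (hx : x ∈ c.Psi) (hy : y ∈ c.Psi) (h : x < y) :
    c.v (y - x) = (c.s x : V) := by
  rw [c.v_of_ne (sub_pos.mpr h).ne', c.psi_sub x hx y hy h]

theorem pos_of_mem_Psi {x : V} (hx : x ∈ c.Psi) : 0 < x :=
  c.s_zero_pos.trans_le (c.s_zero_le x hx)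

theorem s_lt_s {x y : V} (hx : x ∈ c.Psi) (hy : y ∈ c.Psi) (h : x < y) : c.s x < c.s y :=
  (c.s_le x hx y hy h).trans_lt (c.lt_s y hy)

theorem s_inj {x y : V} (hx : x ∈ c.Psi) (hy : y ∈ c.Psi) (h : c.s x = c.s y) : x = y := by
  rcases lt_trichotomy x y with h1 | h1 | h1
  · exact absurd h (c.s_lt_s hx hy h1).ne
  · exact h1
  · exact absurd h (c.s_lt_s hy hx h1).ne'

theorem s_ne_s_zero {x : V} (hx : x ∈ c.Psi) : c.s x ≠ c.s 0 :=
  ((c.s_zero_le x hx).trans_lt (c.lt_s x hx)).ne'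

theorem p_s {x : V} (hx : x ∈ c.Psi) : c.p (c.s x) = x :=
  c.s_inj (c.p_mem _ (c.s_mem x) (c.s_ne_s_zero hx)) hx
    (c.s_p _ (c.s_mem x) (c.s_ne_s_zero hx))

/-- In `a - z = (a - s a) - (z - s a)` the first difference has value `s a`, and the second is `0`
or has the larger value `s (s a)`. -/
theorem v_sub_of_s_le {a z : V} (hz : z ∈ c.Psi) (h : c.s a ≤ z) :
    c.v (a - z) = (c.s a : V) := by
  rcases h.eq_or_lt with h | h
  · rw [← h, c.v_sub_s]
  · have h1 : a - z = (a - c.s a) - (z - c.s a) := by abel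
    rw [h1, c.v_sub_of_lt, c.v_sub_s]
    rw [c.v_sub_s, c.v_sub_Psi (c.s_mem a) hz h]
    exact_mod_cast c.lt_s _ (c.s_mem a)

theorem lt_v_sub_of_lt_s {a z : V} (hz : z ∈ c.Psi) (h : z < c.s a) :
    (z : WithTop V) < c.v (a - z) := by
  have h1 : a - z = (a - c.s a) + (c.s a - z) := by abel
  rw [h1]
  apply c.lt_v_add
  · rw [c.v_sub_s]; exact_mod_cast h
  · rw [c.v_sub_Psi hz (c.s_mem a) h]; exact_mod_cast c.lt_s _ hz

/-- This reads off `s` from `ψ` by means of any sufficiently large `z` in `Ψ`. It is how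
compatibility with `s` is obtained when an isomorphism is extended. -/
theorem s_eq_of_v_sub {a z y : V} (hz : z ∈ c.Psi) (h : c.v (a - z) = (y : WithTop V))
    (hy : y ≤ z) : c.s a = y := by
  have h1 : c.s a ≤ z := by
    by_contra h'
    have := c.lt_v_sub_of_lt_s hz (not_le.mp h')
    rw [h] at this
    exact absurd (by exact_mod_cast this) (not_lt.mpr hy)
  have := c.v_sub_of_s_le hz h1
  rw [h] at this
  exact_mod_cast this.symm

/-- For `x ∈ Ψ` the positive element `x - p x` has value `x`. -/
theorem sub_p {x : V} (hx : x ∈ c.Psi) : 0 < x - c.p x ∧ c.psi (x - c.p x) = x := by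
  by_cases h : x = c.s 0
  -- Here the default `p (s 0) = 0` is the right value: `s 0 - 0` is the negative of `0 - s 0`,
  -- which has value `s 0`.
  · rw [c.p_zero x (Or.inr h), sub_zero]
    refine ⟨c.pos_of_mem_Psi hx, ?_⟩
    have := c.psi_sub_s 0
    rw [zero_sub, c.psi_neg] at this
    rw [h, this]
  · have h1 := c.p_mem x hx h
    have h2 := c.s_p x hx h
    have h3 : c.p x < x := by
      have := c.lt_s _ h1
      rwa [h2] at this
    exact ⟨sub_pos.mpr h3, by rw [c.psi_sub _ h1 _ hx h3, h2]⟩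

end LogCouple

/-! ### Closed subspaces, partial isomorphisms, and `s`-chains off a closed subspace. -/

namespace LogCouple

variable {V : Type*} [AddCommGroup V] [LinearOrder V] [IsOrderedAddMonoid V] [Module ℚ V]
  (c : LogCouple V)

/-- A subspace closed under `ψ`, `s` and `p`. -/
structure IsClosed (A : Submodule ℚ V) : Prop where
  psi : ∀ {a}, a ∈ A → c.psi a ∈ A
  s : ∀ {a}, a ∈ A → c.s a ∈ A
  p : ∀ {a}, a ∈ A → c.p a ∈ A

/-- The graph `G` is that of an isomorphism between two closed subspaces. -/
structure PIso (G : Submodule ℚ (V × V)) : Prop where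
  pos : ∀ {a b}, (a, b) ∈ G → (0 < a ↔ 0 < b)
  -- Iterates of `p` are required only on values of `ψ`. This suffices to preserve `Ψ` and `p`, and
  -- it spares any decision about which elements of an extension belong to `Ψ`.
  psi : ∀ {a b}, (a, b) ∈ G → ∀ k : ℕ, (c.p^[k] (c.psi a), c.p^[k] (c.psi b)) ∈ G
  s : ∀ {a b}, (a, b) ∈ G → (c.s a, c.s b) ∈ G

variable {c}

theorem IsClosed.s_mem_iff {A : Submodule ℚ V} (hA : c.IsClosed A) {x : V} (hx : x ∈ c.Psi) :
    c.s x ∈ A ↔ x ∈ A := by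
  refine ⟨fun h => ?_, hA.s⟩
  have := hA.p h
  rwa [c.p_s hx] at this

namespace PIso

variable {G : Submodule ℚ (V × V)}

theorem zero_iff (hG : c.PIso G) {a b : V} (h : (a, b) ∈ G) : a = 0 ↔ b = 0 := by
  have h1 := hG.pos h
  have h2 := hG.pos (G.neg_mem h)
  simp only [Left.neg_pos_iff] at h2
  constructor
  · rintro rfl
    exact le_antisymm (not_lt.mp (h1.not.mp (lt_irrefl _))) (not_lt.mp (h2.not.mp (lt_irrefl _)))
  · rintro rfl
    exact le_antisymm (not_lt.mp (h1.not.mpr (lt_irrefl _))) (not_lt.mp (h2.not.mpr (lt_irrefl _)))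

theorem lt_iff (hG : c.PIso G) {a b a' b' : V} (h : (a, b) ∈ G) (h' : (a', b') ∈ G) :
    a < a' ↔ b < b' := by
  rw [← sub_pos, hG.pos (G.sub_mem h' h), sub_pos]

theorem eq_iff (hG : c.PIso G) {a b a' b' : V} (h : (a, b) ∈ G) (h' : (a', b') ∈ G) :
    a = a' ↔ b = b' := by
  rw [← sub_eq_zero, hG.zero_iff (G.sub_mem h h'), sub_eq_zero]

theorem le_iff (hG : c.PIso G) {a b a' b' : V} (h : (a, b) ∈ G) (h' : (a', b') ∈ G) :
    a ≤ a' ↔ b ≤ b' := by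
  rw [← not_lt, hG.lt_iff h' h, not_lt]

theorem psi' (hG : c.PIso G) {a b : V} (h : (a, b) ∈ G) : (c.psi a, c.psi b) ∈ G :=
  hG.psi h 0

theorem symm (hG : c.PIso G) : c.PIso (G.comap (LinearEquiv.prodComm ℚ V V).toLinearMap) where
  pos h := (hG.pos (by simpa using h)).symm
  psi h k := by simpa using hG.psi (by simpa using h) k
  s h := by simpa using hG.s (by simpa using h)

theorem mem_symm {a b : V} :
    (a, b) ∈ G.comap (LinearEquiv.prodComm ℚ V V).toLinearMap ↔ (b, a) ∈ G := by simp

/-- Membership in `Ψ` is expressed by the functions: `a ∈ Ψ` exactly when `a = p (ψ (a - s a))` and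
`s a ≠ s 0`, because `ψ (a - s a) = s a`. -/
theorem mem_Psi (hG : c.PIso G) {a b : V} (h : (a, b) ∈ G) (ha : a ∈ c.Psi) : b ∈ c.Psi := by
  have h1 := hG.psi (G.sub_mem h (hG.s h)) 1
  simp only [Function.iterate_one] at h1
  rw [c.psi_sub_s, c.psi_sub_s, c.p_s ha] at h1
  have h2 : b = c.p (c.s b) := (hG.eq_iff h h1).mp rfl
  rw [h2]
  refine c.p_mem _ (c.s_mem b) ?_
  rw [Ne, ← hG.eq_iff (hG.s h) (hG.s (G.zero_mem : ((0 : V), (0 : V)) ∈ G))]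
  exact c.s_ne_s_zero ha

theorem mem_Psi_iff (hG : c.PIso G) {a b : V} (h : (a, b) ∈ G) : a ∈ c.Psi ↔ b ∈ c.Psi :=
  ⟨hG.mem_Psi h, hG.symm.mem_Psi (mem_symm.mpr h)⟩

theorem p_mem (hG : c.PIso G) {a b : V} (h : (a, b) ∈ G) : (c.p a, c.p b) ∈ G := by
  by_cases ha : a ∈ c.Psi
  · have h1 := hG.psi (G.sub_mem h (hG.s h)) 2
    simp only [Function.iterate_succ, Function.iterate_zero, Function.comp_apply, id] at h1
    rwa [c.psi_sub_s, c.psi_sub_s, c.p_s ha, c.p_s (hG.mem_Psi h ha)] at h1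
  · rw [c.p_zero a (Or.inl ha), c.p_zero b (Or.inl (fun hb => ha ((hG.mem_Psi_iff h).mpr hb)))]
    exact G.zero_mem

theorem iterate_p_mem (hG : c.PIso G) {x y : V} (h : (x, y) ∈ G) (k : ℕ) :
    (c.p^[k] x, c.p^[k] y) ∈ G := by
  induction k with
  | zero => simpa
  | succ k ih => simpa [Function.iterate_succ_apply'] using hG.p_mem ih

theorem mem_dom {a : V} : a ∈ G.map (LinearMap.fst ℚ V V) ↔ ∃ b, (a, b) ∈ G := by simp

theorem mem_ran {b : V} : b ∈ G.map (LinearMap.snd ℚ V V) ↔ ∃ a, (a, b) ∈ G := by simp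

theorem isClosed_dom (hG : c.PIso G) : c.IsClosed (G.map (LinearMap.fst ℚ V V)) where
  psi h := by
    obtain ⟨b, hb⟩ := mem_dom.mp h
    exact mem_dom.mpr ⟨_, hG.psi' hb⟩
  s h := by
    obtain ⟨b, hb⟩ := mem_dom.mp h
    exact mem_dom.mpr ⟨_, hG.s hb⟩
  p h := by
    obtain ⟨b, hb⟩ := mem_dom.mp h
    exact mem_dom.mpr ⟨_, hG.p_mem hb⟩

theorem isClosed_ran (hG : c.PIso G) : c.IsClosed (G.map (LinearMap.snd ℚ V V)) where
  psi h := by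
    obtain ⟨b, hb⟩ := mem_ran.mp h
    exact mem_ran.mpr ⟨_, hG.psi' hb⟩
  s h := by
    obtain ⟨b, hb⟩ := mem_ran.mp h
    exact mem_ran.mpr ⟨_, hG.s hb⟩
  p h := by
    obtain ⟨b, hb⟩ := mem_ran.mp h
    exact mem_ran.mpr ⟨_, hG.p_mem hb⟩

end PIso

/-- The identity on `A`. -/
def diag (A : Submodule ℚ V) : Submodule ℚ (V × V) :=
  A.map (LinearMap.prod LinearMap.id LinearMap.id)

theorem mem_diag {A : Submodule ℚ V} {a b : V} : (a, b) ∈ diag A ↔ a ∈ A ∧ a = b := by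
  simp only [diag, Submodule.mem_map, LinearMap.prod_apply, Function.prod_apply, LinearMap.id_apply,
    Prod.mk.injEq]
  constructor
  · rintro ⟨x, hx, rfl, rfl⟩
    exact ⟨hx, rfl⟩
  · rintro ⟨h, rfl⟩
    exact ⟨a, h, rfl, rfl⟩

theorem IsClosed.pIso_diag {A : Submodule ℚ V} (hA : c.IsClosed A) : c.PIso (diag A) where
  pos h := by rw [(mem_diag.mp h).2]
  psi h k := by
    obtain ⟨h1, rfl⟩ := mem_diag.mp h
    refine mem_diag.mpr ⟨?_, rfl⟩
    induction k with
    | zero => exact hA.psi h1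
    | succ k ih => rw [Function.iterate_succ_apply']; exact hA.p ih
  s h := by
    obtain ⟨h1, rfl⟩ := mem_diag.mp h
    exact mem_diag.mpr ⟨hA.s h1, rfl⟩

variable (c) in
/-- `x` is a `ℤ`-indexed `s`-chain in `Ψ` none of whose members lies in `A`. -/
structure IsPsiChain (A : Submodule ℚ V) (x : ℤ → V) : Prop where
  mem : ∀ k, x k ∈ c.Psi
  s : ∀ k, c.s (x k) = x (k + 1)
  notMem : ∀ k, x k ∉ A

/-! ### Value and sign of linear combinations of a chain. -/

namespace IsPsiChain

variable {A : Submodule ℚ V} {x : ℤ → V}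

theorem strictMono (hx : c.IsPsiChain A x) : StrictMono x :=
  strictMono_int_of_lt_succ fun k => by
    rw [← hx.s]
    exact c.lt_s _ (hx.mem k)

theorem p (hx : c.IsPsiChain A x) (k : ℤ) : c.p (x (k + 1)) = x k := by
  rw [← hx.s, c.p_s (hx.mem k)]

theorem iterate_p (hx : c.IsPsiChain A x) (n : ℕ) (k : ℤ) : c.p^[n] (x k) = x (k - n) := by
  induction n with
  | zero => simp
  | succ n ih =>
    rw [Function.iterate_succ_apply', ih]
    have := hx.p (k - n - 1)
    rw [sub_add_cancel] at this
    rw [this]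
    congr 1
    push_cast
    ring

/-- An element of `Ψ ∩ A` lies on the same side of all members of the chain. -/
theorem lt_of_lt (hx : c.IsPsiChain A x) {a : V} (ha : a ∈ A) (haP : a ∈ c.Psi) {i : ℤ}
    (h : x i < a) (j : ℤ) : x j < a := by
  have step : ∀ n : ℕ, x (i + n) < a := by
    intro n
    induction n with
    | zero => simpa
    | succ n ih =>
      have h1 := c.s_le _ (hx.mem _) _ haP ih
      rw [hx.s] at h1
      push_cast
      rw [← add_assoc]
      refine lt_of_le_of_ne h1 fun h2 => ?_
      exact hx.notMem _ (h2 ▸ ha)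
  refine (hx.strictMono.monotone ?_).trans_lt (step (j - i).toNat)
  have := Int.self_le_toNat (j - i)
  omega

theorem ne (hx : c.IsPsiChain A x) {a : V} (ha : a ∈ A) (i : ℤ) : a ≠ x i :=
  fun h => hx.notMem i (h ▸ ha)

theorem lt_iff (hx : c.IsPsiChain A x) {a : V} (ha : a ∈ A) (haP : a ∈ c.Psi) (i j : ℤ) :
    x i < a ↔ x j < a :=
  ⟨fun h => hx.lt_of_lt ha haP h j, fun h => hx.lt_of_lt ha haP h i⟩

variable (x) in
/-- The element `∑ q_k x_k`. -/
noncomputable def comb (q : ℤ →₀ ℚ) : V := Finsupp.linearCombination ℚ x q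

/-- The sum of the coefficients. -/
noncomputable def coeffSum (q : ℤ →₀ ℚ) : ℚ := Finsupp.linearCombination ℚ (fun _ => (1 : ℚ)) q

variable (c) in
/-- The element of `A` that governs the value and the sign of `a + ∑ q_k x_k`. -/
noncomputable def core (a : V) (q : ℤ →₀ ℚ) : V :=
  a + coeffSum q • c.s (-((coeffSum q)⁻¹ • a))

theorem core_mem (hA : c.IsClosed A) {a : V} (ha : a ∈ A) (q : ℤ →₀ ℚ) : core c a q ∈ A :=
  A.add_mem ha (A.smul_mem _ (hA.s (A.neg_mem (A.smul_mem _ ha))))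

/-- The combination is compared with its coefficient sum times a later chain member `x N`. The
difference is `∑ q k • (x N - x k)`, where `x N - x k` is positive of value `x (k + 1)`; the term of
least index `m` therefore dominates. -/
theorem v_tail (hx : c.IsPsiChain A x) {q : ℤ →₀ ℚ} {m N : ℤ} (hm : m ∈ q.support)
    (hmin : ∀ k ∈ q.support, m ≤ k) (hN : ∀ k ∈ q.support, k < N) :
    c.v (coeffSum q • x N - comb x q) = (x (m + 1) : V) ∧
      (0 < coeffSum q • x N - comb x q ↔ 0 < q m) := by
  have hqm : q m ≠ 0 := Finsupp.mem_support_iff.mp hm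
  have h0 : coeffSum q • x N - comb x q = q m • (x N - x m)
      + ∑ k ∈ q.support.erase m, q k • (x N - x k) := by
    rw [Finset.add_sum_erase _ (fun k => q k • (x N - x k)) hm, coeffSum, comb, Finsupp.linearCombination_apply,
      Finsupp.linearCombination_apply, Finsupp.sum, Finsupp.sum, Finset.sum_smul,
      ← Finset.sum_sub_distrib]
    simp [smul_sub]
  have h1 : c.v (q m • (x N - x m)) = (x (m + 1) : V) := by
    rw [c.v_smul hqm, c.v_sub_Psi (hx.mem m) (hx.mem N) (hx.strictMono (hN m hm)), hx.s]
  have h2 : (x (m + 1) : WithTop V) < c.v (∑ k ∈ q.support.erase m, q k • (x N - x k)) := by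
    refine c.lt_v_sum _ _ fun k hk => ?_
    obtain ⟨hk1, hk2⟩ := Finset.mem_erase.mp hk
    rw [c.v_smul (Finsupp.mem_support_iff.mp hk2),
      c.v_sub_Psi (hx.mem k) (hx.mem N) (hx.strictMono (hN k hk2)), hx.s]
    have := hmin k hk2
    exact_mod_cast hx.strictMono (by omega)
  have h3 : c.v (q m • (x N - x m)) < c.v (∑ k ∈ q.support.erase m, q k • (x N - x k)) :=
    h1 ▸ h2
  have h4 : 0 < x N - x m := sub_pos.mpr (hx.strictMono (hN m hm))
  rw [h0]
  refine ⟨by rw [c.v_add_of_lt h3, h1], ?_⟩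
  rw [c.pos_add_iff_of_lt h3]
  rcases lt_or_gt_of_ne hqm with h | h
  · refine iff_of_false ?_ (not_lt.mpr h.le)
    have := rat_smul_pos (neg_pos.mpr h) h4
    rw [neg_smul] at this
    exact (neg_pos.mp this).not_gt
  · exact iff_of_true (rat_smul_pos h h4) h

/-- With coefficient sum `Q ≠ 0` and `σ = s (-a/Q)`, the core `a + Q σ` has value `σ ∈ A`, and
replacing `σ` by `x N` changes it by `Q (x N - σ)`. If `σ` lies below the chain this change is
negligible; if `σ` lies above the chain both terms have value beyond `x (m + 1)`. Equality is
excluded since the chain avoids `A`. -/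
theorem v_head (hx : c.IsPsiChain A x) (hA : c.IsClosed A) {a : V} (ha : a ∈ A) (q : ℤ →₀ ℚ)
    {m N : ℤ} (hN : m < N) :
    (c.v (core c a q) < (x (m + 1) : V) ∧ c.v (a + coeffSum q • x N) = c.v (core c a q) ∧
      (0 < a + coeffSum q • x N ↔ 0 < core c a q)) ∨
    ((x (m + 1) : V) < c.v (core c a q) ∧ (x (m + 1) : V) < c.v (a + coeffSum q • x N)) := by
  have hmem := core_mem hA ha q
  -- If the coefficient sum vanishes, the head and the core are both `a`.
  by_cases hQ : coeffSum q = 0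
  · have h1 : core c a q = a := by simp [core, hQ]
    have h2 : a + coeffSum q • x N = a := by simp [hQ]
    rw [h1, h2]
    rcases lt_trichotomy (c.v a) (x (m + 1) : V) with h | h | h
    · exact Or.inl ⟨h, rfl, Iff.rfl⟩
    · refine absurd ?_ (hx.notMem (m + 1))
      rw [← (c.v_eq_coe.mp h).2]
      exact hA.psi ha
    · exact Or.inr ⟨h, h⟩
  · set σ := c.s (-((coeffSum q)⁻¹ • a)) with hσ
    have hσA : σ ∈ A := hA.s (A.neg_mem (A.smul_mem _ ha))
    have hσP : σ ∈ c.Psi := c.s_mem _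
    have hcore : core c a q = (-coeffSum q) • (-((coeffSum q)⁻¹ • a) - σ) := by
      rw [smul_sub, smul_neg, neg_smul, smul_inv_smul₀ hQ, neg_smul, neg_neg, sub_neg_eq_add]
      rfl
    have hv : c.v (core c a q) = (σ : V) := by
      rw [hcore, c.v_smul (neg_ne_zero.mpr hQ), hσ, c.v_sub_s]
    have hsum : a + coeffSum q • x N = core c a q + coeffSum q • (x N - σ) := by
      rw [core, smul_sub, ← hσ]; abel
    rcases lt_or_gt_of_ne (hx.ne hσA (m + 1)) with h | h
    · left
      have h1 : σ < x N := h.trans_le (hx.strictMono.monotone (by omega))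
      have h2 : c.v (core c a q) < c.v (coeffSum q • (x N - σ)) := by
        rw [hv, c.v_smul hQ, c.v_sub_Psi hσP (hx.mem N) h1]
        exact_mod_cast c.lt_s _ hσP
      rw [hsum, c.v_add_of_lt h2, c.pos_add_iff_of_lt h2, hv]
      exact ⟨by exact_mod_cast h, rfl, Iff.rfl⟩
    · right
      rw [hv]
      refine ⟨by exact_mod_cast h, ?_⟩
      rw [hsum]
      apply c.lt_v_add
      · rw [hv]; exact_mod_cast h
      · rw [c.v_smul hQ, c.v_sub_comm, c.v_sub_Psi (hx.mem N) hσP (hx.lt_of_lt hσA hσP h N), hx.s]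
        exact_mod_cast hx.strictMono (by omega)

/-- Value and sign of `a + ∑ q_k x_k` for a chain off `A` and `a ∈ A`. -/
theorem v_add_comb (hx : c.IsPsiChain A x) (hA : c.IsClosed A) {a : V} (ha : a ∈ A) {q : ℤ →₀ ℚ}
    {m : ℤ} (hm : m ∈ q.support) (hmin : ∀ k ∈ q.support, m ≤ k) :
    (c.v (core c a q) < (x (m + 1) : V) ∧ c.v (a + comb x q) = c.v (core c a q) ∧
      (0 < a + comb x q ↔ 0 < core c a q)) ∨
    ((x (m + 1) : V) < c.v (core c a q) ∧ c.v (a + comb x q) = (x (m + 1) : V) ∧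
      (0 < a + comb x q ↔ q m < 0)) := by
  obtain ⟨N, hN⟩ : ∃ N, ∀ k ∈ q.support, k < N :=
    ⟨q.support.max' ⟨m, hm⟩ + 1, fun k hk => Int.lt_add_one_of_le (Finset.le_max' _ _ hk)⟩
  have hqm : q m ≠ 0 := Finsupp.mem_support_iff.mp hm
  obtain ⟨ht, ht'⟩ := hx.v_tail hm hmin hN
  set t := coeffSum q • x N - comb x q with ht_def
  have hsum : a + comb x q = (a + coeffSum q • x N) + -t := by rw [ht_def]; abel
  have ht0 : t ≠ 0 := by
    intro h0
    rw [h0, c.v_zero] at ht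
    exact absurd ht (by simp)
  rw [hsum]
  rcases hx.v_head hA ha q (hN m hm) with ⟨h1, h2, h3⟩ | ⟨h1, h2⟩
  · left
    have h4 : c.v (a + coeffSum q • x N) < c.v (-t) := by rw [h2, c.v_neg, ht]; exact h1
    rw [c.v_add_of_lt h4, c.pos_add_iff_of_lt h4]
    exact ⟨h1, h2, h3⟩
  · right
    have h4 : c.v (-t) < c.v (a + coeffSum q • x N) := by rw [c.v_neg, ht]; exact h2
    rw [add_comm (a + _), c.v_add_of_lt h4, c.pos_add_iff_of_lt h4, c.v_neg, ht]
    refine ⟨h1, rfl, ?_⟩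
    rw [Left.neg_pos_iff]
    constructor
    · intro h
      by_contra h'
      exact absurd (ht'.mpr (lt_of_le_of_ne (not_lt.mp h') hqm.symm)) h.not_gt
    · intro h
      refine lt_of_le_of_ne (not_lt.mp fun h' => ?_) ht0
      exact absurd (ht'.mp h') h.not_gt

theorem v_add_comb_le (hx : c.IsPsiChain A x) (hA : c.IsClosed A) {a : V} (ha : a ∈ A)
    {q : ℤ →₀ ℚ} {m : ℤ} (hm : m ∈ q.support) (hmin : ∀ k ∈ q.support, m ≤ k) :
    c.v (a + comb x q) ≤ (x (m + 1) : V) := by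
  rcases hx.v_add_comb hA ha hm hmin with ⟨h1, h2, -⟩ | ⟨-, h2, -⟩
  · rw [h2]; exact h1.le
  · exact h2.le

theorem exists_min {q : ℤ →₀ ℚ} (hq : q ≠ 0) : ∃ m ∈ q.support, ∀ k ∈ q.support, m ≤ k :=
  ⟨_, Finset.min'_mem _ (Finsupp.support_nonempty_iff.mpr hq), fun _ hk => Finset.min'_le _ _ hk⟩

/-- The chain is linearly independent modulo `A`, since a nontrivial combination has finite value.
-/
theorem add_comb_ne_zero (hx : c.IsPsiChain A x) (hA : c.IsClosed A) {a : V} (ha : a ∈ A)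
    {q : ℤ →₀ ℚ} (hq : q ≠ 0) : a + comb x q ≠ 0 := by
  obtain ⟨m, hm, hmin⟩ := exists_min hq
  intro h
  have := hx.v_add_comb_le hA ha hm hmin
  rw [h, c.v_zero] at this
  exact absurd this (by simp)

end IsPsiChain

end LogCouple

/-! ### Extending an isomorphism by a pair of chains. -/

namespace LogCouple

variable {V : Type*} [AddCommGroup V] [LinearOrder V] [IsOrderedAddMonoid V] [Module ℚ V]
  {c : LogCouple V}

open IsPsiChain

/-- The graph `G` extended by the pairs `(x k, y k)`. -/
def addChain (G : Submodule ℚ (V × V)) (x y : ℤ → V) : Submodule ℚ (V × V) :=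
  G ⊔ Submodule.span ℚ (Set.range fun k => (x k, y k))

theorem mem_addChain {G : Submodule ℚ (V × V)} {x y : ℤ → V} {α β : V} :
    (α, β) ∈ addChain G x y ↔
      ∃ a b q, (a, b) ∈ G ∧ α = a + comb x q ∧ β = b + comb y q := by
  have key : ∀ q : ℤ →₀ ℚ, (q.sum fun i r => r • (x i, y i)) = (comb x q, comb y q) := by
    intro q
    simp only [comb, Finsupp.linearCombination_apply, Finsupp.sum]
    ext
    · simp [Prod.fst_sum]
    · simp [Prod.snd_sum]
  rw [addChain, Submodule.mem_sup]
  constructor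
  · rintro ⟨⟨a, b⟩, hab, z, hz, h⟩
    obtain ⟨q, rfl⟩ := Finsupp.mem_span_range_iff_exists_finsupp.mp hz
    rw [key] at h
    simp only [Prod.mk_add_mk, Prod.mk.injEq] at h
    exact ⟨a, b, q, hab, h.1.symm, h.2.symm⟩
  · rintro ⟨a, b, q, hab, rfl, rfl⟩
    exact ⟨(a, b), hab, _, Finsupp.mem_span_range_iff_exists_finsupp.mpr ⟨q, rfl⟩, by
      rw [key]; rfl⟩

theorem le_addChain (G : Submodule ℚ (V × V)) (x y : ℤ → V) : G ≤ addChain G x y := le_sup_left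

theorem chain_mem_addChain (G : Submodule ℚ (V × V)) (x y : ℤ → V) (k : ℤ) :
    (x k, y k) ∈ addChain G x y :=
  (le_sup_right : _ ≤ addChain G x y) (Submodule.subset_span ⟨k, rfl⟩)

theorem PIso.core_mem {G : Submodule ℚ (V × V)} (hG : c.PIso G) {a b : V} (h : (a, b) ∈ G)
    (q : ℤ →₀ ℚ) : (core c a q, core c b q) ∈ G :=
  G.add_mem h (G.smul_mem (coeffSum q) (hG.s (G.neg_mem (G.smul_mem (coeffSum q)⁻¹ h))))

section

variable {G : Submodule ℚ (V × V)} {x y : ℤ → V}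

/-- A value of an element of the domain lies in the domain and in `Ψ`, hence on one side of the
whole chain. The cut hypothesis at index `0` thus governs every index. -/
theorem v_lt_chain_iff (hG : c.PIso G) (hx : c.IsPsiChain (G.map (LinearMap.fst ℚ V V)) x)
    (hy : c.IsPsiChain (G.map (LinearMap.snd ℚ V V)) y)
    (hcut : ∀ a b, (a, b) ∈ G → a ∈ c.Psi → (x 0 < a ↔ y 0 < b)) {a b : V} (h : (a, b) ∈ G)
    (k : ℤ) :
    ((x k : WithTop V) < c.v a ↔ (y k : WithTop V) < c.v b) := by
  by_cases h0 : a = 0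
  · have h1 := (hG.zero_iff h).mp h0
    subst h0 h1
    simp [c.v_zero]
  · have h1 := (hG.zero_iff h).not.mp h0
    rw [c.v_of_ne h0, c.v_of_ne h1]
    have h2 := hG.psi' h
    simp only [WithTop.coe_lt_coe]
    rw [hx.lt_iff (PIso.mem_dom.mpr ⟨_, h2⟩) (c.psi_mem a h0) k 0,
      hy.lt_iff (PIso.mem_ran.mpr ⟨_, h2⟩) (c.psi_mem b h1) k 0]
    exact hcut _ _ h2 (c.psi_mem a h0)

/-- Value, sign and successor of corresponding elements of `addChain G x y`. -/
theorem addChain_aux (hG : c.PIso G) (hx : c.IsPsiChain (G.map (LinearMap.fst ℚ V V)) x)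
    (hy : c.IsPsiChain (G.map (LinearMap.snd ℚ V V)) y)
    (hcut : ∀ a b, (a, b) ∈ G → a ∈ c.Psi → (x 0 < a ↔ y 0 < b)) {a b : V} (h : (a, b) ∈ G)
    {q : ℤ →₀ ℚ} (hq : q ≠ 0) :
    (0 < a + comb x q ↔ 0 < b + comb y q) ∧
      ((c.psi (a + comb x q), c.psi (b + comb y q)) ∈ G ∨
        ∃ k, c.psi (a + comb x q) = x k ∧ c.psi (b + comb y q) = y k) := by
  obtain ⟨m, hm, hmin⟩ := exists_min hq
  have ha : a ∈ G.map (LinearMap.fst ℚ V V) := PIso.mem_dom.mpr ⟨_, h⟩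
  have hb : b ∈ G.map (LinearMap.snd ℚ V V) := PIso.mem_ran.mpr ⟨_, h⟩
  have hc := hG.core_mem h q
  have hiff := v_lt_chain_iff hG hx hy hcut hc (m + 1)
  rcases hx.v_add_comb hG.isClosed_dom ha hm hmin with ⟨h1, h2, h3⟩ | ⟨h1, h2, h3⟩ <;>
  rcases hy.v_add_comb hG.isClosed_ran hb hm hmin with ⟨h1', h2', h3'⟩ | ⟨h1', h2', h3'⟩
  · refine ⟨by rw [h3, h3', hG.pos hc], Or.inl ?_⟩
    have hne : core c a q ≠ 0 := by
      intro h0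
      rw [h0, c.v_zero] at h1
      exact absurd h1 (by simp)
    have hne' := (hG.zero_iff hc).not.mp hne
    rw [c.v_of_ne hne, c.v_eq_coe] at h2
    rw [c.v_of_ne hne', c.v_eq_coe] at h2'
    rw [h2.2, h2'.2]
    exact hG.psi' hc
  · exact absurd (hiff.mpr h1') h1.not_gt
  · exact absurd (hiff.mp h1) h1'.not_gt
  · exact ⟨by rw [h3, h3'], Or.inr ⟨m + 1, (c.v_eq_coe.mp h2).2, (c.v_eq_coe.mp h2').2⟩⟩

theorem addChain_psi (hG : c.PIso G) (hx : c.IsPsiChain (G.map (LinearMap.fst ℚ V V)) x)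
    (hy : c.IsPsiChain (G.map (LinearMap.snd ℚ V V)) y)
    (hcut : ∀ a b, (a, b) ∈ G → a ∈ c.Psi → (x 0 < a ↔ y 0 < b)) {α β : V}
    (h : (α, β) ∈ addChain G x y) :
    (0 < α ↔ 0 < β) ∧ ((c.psi α, c.psi β) ∈ G ∨ ∃ k, c.psi α = x k ∧ c.psi β = y k) := by
  obtain ⟨a, b, q, hab, rfl, rfl⟩ := mem_addChain.mp h
  by_cases hq : q = 0
  · subst hq
    simp only [comb, map_zero, add_zero]
    exact ⟨hG.pos hab, Or.inl (hG.psi' hab)⟩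
  · exact addChain_aux hG hx hy hcut hab hq

/-- This supplies one `N` at which `s_eq_psi_sub` computes `s` of both corresponding elements, which
reduces `s` on the extension to `ψ` on the extension. -/
theorem exists_sub_chain (hG : c.PIso G) (hx : c.IsPsiChain (G.map (LinearMap.fst ℚ V V)) x)
    (hy : c.IsPsiChain (G.map (LinearMap.snd ℚ V V)) y) {a b : V} (h : (a, b) ∈ G)
    {q : ℤ →₀ ℚ} (hq : q ≠ 0) :
    ∃ N, c.v (a + comb x q - x N) ≤ (x N : V) ∧ c.v (b + comb y q - y N) ≤ (y N : V) := by
  obtain ⟨m, hm, hmin⟩ := exists_min hq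
  obtain ⟨N, hN⟩ : ∃ N, ∀ k ∈ q.support, k < N :=
    ⟨q.support.max' ⟨m, hm⟩ + 1, fun k hk => Int.lt_add_one_of_le (Finset.le_max' _ _ hk)⟩
  -- As `N` lies beyond the support, subtracting `x N` leaves the least index `m` and its
  -- coefficient unchanged; the value is then at most `x (m + 1) ≤ x N`.
  have hmN := hN m hm
  set q' := q - Finsupp.single N 1 with hq'
  have hm' : m ∈ q'.support := by
    rw [Finsupp.mem_support_iff, hq', Finsupp.sub_apply, Finsupp.single_apply, if_neg hmN.ne',
      sub_zero]
    exact Finsupp.mem_support_iff.mp hm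
  have hmin' : ∀ k ∈ q'.support, m ≤ k := by
    intro k hk
    by_cases hkN : k = N
    · exact hkN ▸ hmN.le
    · apply hmin
      rw [Finsupp.mem_support_iff, hq', Finsupp.sub_apply, Finsupp.single_apply,
        if_neg (Ne.symm hkN), sub_zero] at hk
      exact Finsupp.mem_support_iff.mpr hk
  have hcomb : ∀ z : ℤ → V, ∀ d : V, d + comb z q - z N = d + comb z q' := by
    intro z d
    simp only [comb, hq', map_sub, Finsupp.linearCombination_single, one_smul]
    abel
  refine ⟨N, ?_, ?_⟩
  · rw [hcomb]
    refine (hx.v_add_comb_le hG.isClosed_dom (PIso.mem_dom.mpr ⟨_, h⟩) hm' hmin').trans ?_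
    exact_mod_cast hx.strictMono.monotone (by omega)
  · rw [hcomb]
    refine (hy.v_add_comb_le hG.isClosed_ran (PIso.mem_ran.mpr ⟨_, h⟩) hm' hmin').trans ?_
    exact_mod_cast hy.strictMono.monotone (by omega)

theorem s_eq_psi_sub {a z : V} (hz : z ∈ c.Psi) (h : c.v (a - z) ≤ (z : WithTop V)) :
    c.s a = c.psi (a - z) := by
  have hne : a - z ≠ 0 := by
    intro h0
    rw [h0, c.v_zero] at h
    exact absurd h (by simp)
  rw [c.v_of_ne hne] at h
  exact c.s_eq_of_v_sub hz (c.v_of_ne hne) (by exact_mod_cast h)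

theorem PIso.addChain (hG : c.PIso G) (hx : c.IsPsiChain (G.map (LinearMap.fst ℚ V V)) x)
    (hy : c.IsPsiChain (G.map (LinearMap.snd ℚ V V)) y)
    (hcut : ∀ a b, (a, b) ∈ G → a ∈ c.Psi → (x 0 < a ↔ y 0 < b)) :
    c.PIso (addChain G x y) where
  pos h := (addChain_psi hG hx hy hcut h).1
  psi h k := by
    rcases (addChain_psi hG hx hy hcut h).2 with h1 | ⟨j, h1, h2⟩
    · exact le_addChain _ _ _ (hG.iterate_p_mem h1 k)
    · rw [h1, h2, hx.iterate_p, hy.iterate_p]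
      exact chain_mem_addChain _ _ _ _
  s {α β} h := by
    obtain ⟨a, b, q, hab, rfl, rfl⟩ := mem_addChain.mp h
    by_cases hq : q = 0
    · subst hq
      simp only [comb, map_zero, add_zero]
      exact le_addChain _ _ _ (hG.s hab)
    · obtain ⟨N, h1, h2⟩ := exists_sub_chain hG hx hy hab hq
      rw [s_eq_psi_sub (hx.mem N) h1, s_eq_psi_sub (hy.mem N) h2]
      have h3 : (a + comb x q - x N, b + comb y q - y N) ∈ LogCouple.addChain G x y :=
        Submodule.sub_mem _ h (chain_mem_addChain G x y N)
      rcases (addChain_psi hG hx hy hcut h3).2 with h4 | ⟨j, h4, h5⟩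
      · exact le_addChain _ _ _ h4
      · rw [h4, h5]
        exact chain_mem_addChain _ _ _ _

/-- If the new chain avoids `C`, so do the new elements. -/
theorem mem_of_addChain {C : Submodule ℚ V} (hC : c.IsClosed C)
    (hGC : G.map (LinearMap.snd ℚ V V) ≤ C) (hy : c.IsPsiChain C y) {α β : V}
    (h : (α, β) ∈ addChain G x y) (hβ : β ∈ C) : (α, β) ∈ G := by
  obtain ⟨a, b, q, hab, rfl, rfl⟩ := mem_addChain.mp h
  by_cases hq : q = 0
  · subst hq
    simpa [comb] using hab
  -- With `β = b + comb y q`, both `β` and `b` lie in `C`, and `(-β + b) + comb y q = 0` contradicts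
  -- the independence of the chain modulo `C`.
  · refine absurd ?_ (hy.add_comb_ne_zero hC (a := -(b + comb y q) + b)
      (C.add_mem (C.neg_mem hβ) (hGC (PIso.mem_ran.mpr ⟨_, hab⟩))) hq)
    abel

end

variable (c) in
/-- The chain `k ↦ s^k x`. -/
noncomputable def chain (x : V) : ℤ → V
  | Int.ofNat m => c.s^[m] x
  | Int.negSucc m => c.p^[m + 1] x

@[simp] theorem chain_zero (x : V) : chain c x 0 = x := rfl

/-- Since `s 0 ∈ A`, the backward iterates of `x` never reach `s 0`, so `p` can always be applied
again. Membership in `A` is unchanged by `s` on `Ψ`, so no iterate enters `A`. -/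
theorem IsClosed.isPsiChain {A : Submodule ℚ V} (hA : c.IsClosed A) {x : V} (hx : x ∈ c.Psi)
    (hxA : x ∉ A) : c.IsPsiChain A (chain c x) := by
  have h0 : ∀ z, z ∉ A → z ≠ c.s 0 := fun z hz h => hz (h ▸ hA.s A.zero_mem)
  have hup : ∀ n : ℕ, c.s^[n] x ∈ c.Psi ∧ c.s^[n] x ∉ A := by
    intro n
    induction n with
    | zero => exact ⟨hx, hxA⟩
    | succ n ih =>
      rw [Function.iterate_succ_apply']
      exact ⟨c.s_mem _, (hA.s_mem_iff ih.1).not.mpr ih.2⟩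
  have hdown : ∀ n : ℕ, c.p^[n] x ∈ c.Psi ∧ c.p^[n] x ∉ A := by
    intro n
    induction n with
    | zero => exact ⟨hx, hxA⟩
    | succ n ih =>
      rw [Function.iterate_succ_apply']
      have h1 := c.p_mem _ ih.1 (h0 _ ih.2)
      refine ⟨h1, ?_⟩
      rw [← hA.s_mem_iff h1, c.s_p _ ih.1 (h0 _ ih.2)]
      exact ih.2
  refine ⟨?_, ?_, ?_⟩
  · rintro (n | n)
    · exact (hup n).1
    · exact (hdown (n + 1)).1
  · rintro (n | n)
    · change c.s (c.s^[n] x) = c.s^[n + 1] x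
      rw [Function.iterate_succ_apply']
    · have h1 : c.s (c.p^[n + 1] x) = c.p^[n] x := by
        rw [Function.iterate_succ_apply']
        exact c.s_p _ (hdown n).1 (h0 _ (hdown n).2)
      change c.s (c.p^[n + 1] x) = chain c x (Int.negSucc n + 1)
      rw [h1]
      rcases n with _ | n
      · rfl
      · rfl
  · rintro (n | n)
    · exact (hup n).2
    · exact (hdown (n + 1)).2

end LogCouple

/-! ### Countable closed subspaces, saturation, and the realization of types. -/

namespace LogCouple

variable {V : Type*} [AddCommGroup V] [LinearOrder V] [IsOrderedAddMonoid V] [Module ℚ V]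
  {c : LogCouple V}

theorem countable_span (S : Set V) (hS : S.Countable) :
    ((Submodule.span ℚ S : Submodule ℚ V) : Set V).Countable := by
  have : Countable S := hS.to_subtype
  rw [Finsupp.span_eq_range_linearCombination, LinearMap.coe_range]
  exact Set.countable_range _

variable (c) in
/-- One step of the generation of a closed subspace. -/
def closureStep (A : Submodule ℚ V) : Submodule ℚ V :=
  Submodule.span ℚ (A ∪ (c.psi '' A ∪ (c.s '' A ∪ c.p '' A)))

variable (c) in
theorem exists_isClosed (S : Set V) (hS : S.Countable) :
    ∃ A : Submodule ℚ V, c.IsClosed A ∧ (A : Set V).Countable ∧ S ⊆ A := by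
  let f : ℕ → Submodule ℚ V := fun n => (closureStep c)^[n] (Submodule.span ℚ S)
  have hsucc : ∀ n, f (n + 1) = closureStep c (f n) := fun n =>
    Function.iterate_succ_apply' _ _ _
  have hsub : ∀ n, ((f n : Set V) ∪ (c.psi '' f n ∪ (c.s '' f n ∪ c.p '' f n))) ⊆ f (n + 1) := by
    intro n
    rw [hsucc]
    exact Submodule.subset_span
  have hmono : Monotone f := monotone_nat_of_le_succ fun n x hx => hsub n (Or.inl hx)
  have hcount : ∀ n, (f n : Set V).Countable := by
    intro n
    induction n with
    | zero => exact countable_span S hS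
    | succ n ih =>
      rw [hsucc]
      exact countable_span _ (ih.union ((ih.image _).union ((ih.image _).union (ih.image _))))
  have hmem : ∀ x, x ∈ iSup f ↔ ∃ n, x ∈ f n := fun x =>
    Submodule.mem_iSup_of_directed f hmono.directed_le
  refine ⟨iSup f, ⟨fun {a} h => ?_, fun {a} h => ?_, fun {a} h => ?_⟩, ?_, ?_⟩
  · obtain ⟨n, hn⟩ := (hmem a).mp h
    exact (hmem _).mpr ⟨n + 1, hsub n (Or.inr (Or.inl ⟨a, hn, rfl⟩))⟩
  · obtain ⟨n, hn⟩ := (hmem a).mp h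
    exact (hmem _).mpr ⟨n + 1, hsub n (Or.inr (Or.inr (Or.inl ⟨a, hn, rfl⟩)))⟩
  · obtain ⟨n, hn⟩ := (hmem a).mp h
    exact (hmem _).mpr ⟨n + 1, hsub n (Or.inr (Or.inr (Or.inr ⟨a, hn, rfl⟩)))⟩
  · refine (Set.countable_iUnion hcount).mono fun x hx => ?_
    obtain ⟨n, hn⟩ := (hmem x).mp hx
    exact Set.mem_iUnion.mpr ⟨n, hn⟩
  · exact fun x hx => (hmem x).mpr ⟨0, Submodule.subset_span hx⟩

variable (c) in
/-- The quantifier-free conditions on one element used in the back-and-forth. -/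
inductive IsBasic : (V → Prop) → Prop
  | mem_Psi : IsBasic (fun y => y ∈ c.Psi)
  | lt (a : V) : IsBasic (fun y => y < a)
  | eq (a : V) : IsBasic (fun y => y = a)
  | psi (a b : V) : IsBasic (fun y => c.psi (y - a) = b)
  | not {P : V → Prop} : IsBasic P → IsBasic (fun y => ¬ P y)
  | and {P Q : V → Prop} : IsBasic P → IsBasic Q → IsBasic (fun y => P y ∧ Q y)

theorem IsBasic.iff_const {P : V → Prop} (hP : IsBasic c P) (p : Prop) :
    IsBasic c (fun y => (p ↔ P y)) := by
  by_cases h : p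
  · simpa [h] using hP
  · simpa [h] using hP.not

theorem IsBasic.const (p : Prop) : IsBasic c (fun _ => p) := by
  by_cases h : p
  · have : IsBasic c (fun y => ¬ (y = 0 ∧ ¬ y = 0)) := ((IsBasic.eq 0).and (IsBasic.eq 0).not).not
    simpa [h] using this
  · have : IsBasic c (fun y => (y = 0 ∧ ¬ y = 0)) := (IsBasic.eq 0).and (IsBasic.eq 0).not
    simpa [h] using this

theorem IsBasic.imp_const {P : V → Prop} (hP : IsBasic c P) (p : Prop) :
    IsBasic c (fun y => (p → P y)) := by
  by_cases h : p
  · simpa [h] using hP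
  · simpa [h] using IsBasic.const (c := c) True

variable (c) in
/-- Countable saturation for basic conditions. -/
def IsSaturated : Prop :=
  ∀ P : ℕ → V → Prop, (∀ i, IsBasic c (P i)) → (∀ N, ∃ y, ∀ i < N, P i y) → ∃ y, ∀ i, P i y

theorem IsSaturated.exists_of_countable (hsat : c.IsSaturated) {ι : Type*} [Countable ι]
    (P : ι → V → Prop) (hP : ∀ i, IsBasic c (P i))
    (hfin : ∀ F : Finset ι, ∃ y, ∀ i ∈ F, P i y) : ∃ y, ∀ i, P i y := by
  classical
  rcases isEmpty_or_nonempty ι with h | h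
  · exact ⟨0, fun i => (h.false i).elim⟩
  obtain ⟨e, he⟩ := exists_surjective_nat ι
  obtain ⟨y, hy⟩ := hsat (fun n => P (e n)) (fun n => hP _) (fun N => by
    obtain ⟨y, hy⟩ := hfin ((Finset.range N).image e)
    exact ⟨y, fun i hi => hy _ (Finset.mem_image_of_mem _ (Finset.mem_range.mpr hi))⟩)
  refine ⟨y, fun i => ?_⟩
  obtain ⟨n, rfl⟩ := he i
  exact hy n

section

variable {G : Submodule ℚ (V × V)} {C : Submodule ℚ V}

/-- Let `a₁` be the largest of the given elements of `Ψ` below `x`. Then `s a₁` is also below `x`,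
as `x` is not in the domain, so the image `s b₁` of `s a₁` realizes the finite cut. -/
theorem exists_Psi_finite (hG : c.PIso G) {x : V} (hxG : x ∉ G.map (LinearMap.fst ℚ V V))
    (hx : x ∈ c.Psi) (F : Finset G) :
    ∃ y ∈ G.map (LinearMap.snd ℚ V V), y ∈ c.Psi ∧
      ∀ g ∈ F, (g.1.1 ∈ c.Psi → (x < g.1.1 ↔ y < g.1.2)) ∧ y ≠ g.1.2 := by
  classical
  have hne : ∀ a b, (a, b) ∈ G → a ≠ x := fun a b h h' => hxG (h' ▸ PIso.mem_dom.mpr ⟨b, h⟩)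
  -- The pair `(s 0, s 0)` is added so that some element of `Ψ` in the domain lies below `x`.
  let g₀ : G := ⟨(c.s 0, c.s 0), hG.s G.zero_mem⟩
  let K := (insert g₀ F).filter fun g => g.1.1 ∈ c.Psi ∧ g.1.1 < x
  have hg₀ : g₀ ∈ K := Finset.mem_filter.mpr ⟨Finset.mem_insert_self _ _, c.s_mem 0,
    lt_of_le_of_ne (c.s_zero_le x hx) (hne _ _ g₀.2)⟩
  obtain ⟨⟨⟨a₁, b₁⟩, h₁⟩, hK, hmax⟩ := Finset.exists_max_image K (fun g => g.1.1) ⟨g₀, hg₀⟩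
  obtain ⟨-, ha₁, hlt⟩ := Finset.mem_filter.mp hK
  have hs := hG.s h₁
  have hb₁ := hG.mem_Psi h₁ ha₁
  have hsx : c.s a₁ < x := lt_of_le_of_ne (c.s_le _ ha₁ _ hx hlt) (hne _ _ hs)
  refine ⟨c.s b₁, PIso.mem_ran.mpr ⟨_, hs⟩, c.s_mem _, ?_⟩
  rintro ⟨⟨a, b⟩, hab⟩ hF
  by_cases ha : a ∈ c.Psi
  · rcases lt_or_gt_of_ne (hne _ _ hab) with h | h
    · have h1 : a ≤ a₁ := hmax ⟨(a, b), hab⟩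
        (Finset.mem_filter.mpr ⟨Finset.mem_insert_of_mem hF, ha, h⟩)
      have h2 : b < c.s b₁ := ((hG.le_iff hab h₁).mp h1).trans_lt (c.lt_s _ hb₁)
      exact ⟨fun _ => iff_of_false h.not_gt h2.not_gt, h2.ne'⟩
    · have h2 : c.s b₁ < b := (hG.lt_iff hs hab).mp (hsx.trans h)
      exact ⟨fun _ => iff_of_true h h2, h2.ne⟩
  · refine ⟨fun h => absurd h ha, fun h => ?_⟩
    have h1 : b ∈ c.Psi := (show c.s b₁ = b from h) ▸ c.s_mem b₁
    exact ha ((hG.mem_Psi_iff hab).mpr h1)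

/-- The finite solutions lie in the range of `G`, so they automatically avoid any element of `C`
outside the range. Saturation then gives a point avoiding the range and all of `C` at once. -/
theorem exists_Psi (hsat : c.IsSaturated) (hG : c.PIso G) [Countable G]
    (hC : (C : Set V).Countable) {x : V} (hxG : x ∉ G.map (LinearMap.fst ℚ V V)) (hx : x ∈ c.Psi) :
    ∃ y ∈ c.Psi, y ∉ C ∧ ∀ a b, (a, b) ∈ G → a ∈ c.Psi → (x < a ↔ y < b) := by
  classical
  have : Countable C := hC.to_subtype
  let P : G ⊕ {d : C // d.1 ∉ G.map (LinearMap.snd ℚ V V)} → V → Prop := Sum.elim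
    (fun g y => y ∈ c.Psi ∧ ((g.1.1 ∈ c.Psi → (x < g.1.1 ↔ y < g.1.2)) ∧ ¬ y = g.1.2))
    (fun d y => ¬ y = d.1.1)
  obtain ⟨y, hy⟩ := hsat.exists_of_countable P
    (by
      rintro (g | d)
      · exact IsBasic.mem_Psi.and (.and (.imp_const (.iff_const (.lt _) _) _) (.not (.eq _)))
      · exact .not (.eq _))
    (fun F => by
      obtain ⟨y, hy1, hy2, hy3⟩ := exists_Psi_finite hG hxG hx F.toLeft
      refine ⟨y, ?_⟩
      rintro (g | d) hF
      · exact ⟨hy2, hy3 g (Finset.mem_toLeft.mpr hF)⟩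
      · exact fun h => d.2 (h ▸ hy1))
  refine ⟨y, (hy (Sum.inl ⟨0, G.zero_mem⟩)).1, fun hyC => ?_, fun a b hab =>
    (hy (Sum.inl ⟨(a, b), hab⟩)).2.1⟩
  by_cases h : y ∈ G.map (LinearMap.snd ℚ V V)
  · obtain ⟨a, ha⟩ := PIso.mem_ran.mp h
    exact (hy (Sum.inl ⟨(a, y), ha⟩)).2.2 rfl
  · exact hy (Sum.inr ⟨⟨y, hyC⟩, h⟩) rfl

/-- Two nonnegative elements cannot cancel: monotonicity of `ψ` bounds the value above and the
ultrametric inequality bounds it below. -/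
theorem psi_add_of_nonneg {d e x : V} (hd : 0 < d) (hdx : c.psi d = x) (he : 0 ≤ e)
    (hex : (x : WithTop V) ≤ c.v e) : 0 < d + e ∧ c.psi (d + e) = x := by
  have h0 : 0 < d + e := add_pos_of_pos_of_nonneg hd he
  refine ⟨h0, le_antisymm ?_ ?_⟩
  · rw [← hdx]
    exact c.psi_anti _ _ hd (le_add_of_nonneg_right he)
  · have hdv : c.v d = (x : V) := by rw [c.v_of_ne hd.ne', hdx]
    have := c.v_add hdv.ge hex
    rw [c.v_of_ne h0.ne'] at this
    exact_mod_cast this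

/-- Points of `G` at the same distance `x` from `y`: the cut of `y` among them is realized at the
corresponding distance. -/
theorem exists_same_value (hG : c.PIso G) {y x x' : V} (hxG : (x, x') ∈ G) (hx : x ∈ c.Psi)
    (F : Finset (V × V)) (hF : ∀ g ∈ F, g ∈ G) (hv : ∀ g ∈ F, c.v (y - g.1) = (x : V))
    (hne : F.Nonempty) :
    ∃ y' ∈ G.map (LinearMap.snd ℚ V V),
      ∀ g ∈ F, (y < g.1 ↔ y' < g.2) ∧ c.v (y' - g.2) = (x' : V) := by
  classical
  have hdist : ∀ g ∈ F, ∀ h ∈ F, (x' : WithTop V) ≤ c.v (g.2 - h.2) := by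
    intro g hg h hh
    have h1 : (x : WithTop V) ≤ c.v (g.1 - h.1) := by
      have : g.1 - h.1 = (y - h.1) - (y - g.1) := by abel
      rw [this]
      exact c.v_sub (hv h hh).ge (hv g hg).ge
    have h2 : (g.1 - h.1, g.2 - h.2) ∈ G := G.sub_mem (hF g hg) (hF h hh)
    by_cases h0 : g.1 - h.1 = 0
    · rw [(hG.zero_iff h2).mp h0, c.v_zero]; exact le_top
    · rw [c.v_of_ne ((hG.zero_iff h2).not.mp h0)]
      rw [c.v_of_ne h0] at h1
      have := (hG.le_iff hxG (hG.psi' h2)).mp (by exact_mod_cast h1)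
      exact_mod_cast this
  have hyne : ∀ g ∈ F, y ≠ g.1 := by
    intro g hg h
    have := hv g hg
    rw [h, sub_self, c.v_zero] at this
    exact absurd this (by simp)
  have hran : ∀ g ∈ F, g.2 ∈ G.map (LinearMap.snd ℚ V V) := fun g hg =>
    PIso.mem_ran.mpr ⟨g.1, hF g hg⟩
  have hx' := hG.mem_Psi hxG hx
  obtain ⟨he1, he2⟩ := c.sub_p hx'
  -- This is a positive element of value `x'` in the range, used as a step beyond an extreme point
  -- when all of `F` lies on one side of `y`.
  have heran : x' - c.p x' ∈ G.map (LinearMap.snd ℚ V V) :=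
    Submodule.sub_mem _ (PIso.mem_ran.mpr ⟨_, hxG⟩) (PIso.mem_ran.mpr ⟨_, hG.p_mem hxG⟩)
  have hpos : ∀ {a : V}, 0 < a ∧ c.psi a = x' → c.v a = (x' : V) := fun h => by
    rw [c.v_of_ne h.1.ne', h.2]
  have hup : ∀ (y' : V) (d : V), 0 < d → c.psi d = x' → ∀ g₁ ∈ F, g₁.2 - y' = d →
      (∀ g ∈ F, y < g.1 → g₁.1 ≤ g.1) → ∀ g ∈ F, y < g.1 →
      y' < g.2 ∧ c.v (y' - g.2) = (x' : V) := by
    intro y' d hd hdx g₁ hg₁ hy' hmin g hg hlt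
    have h1 := psi_add_of_nonneg hd hdx (sub_nonneg.mpr
      ((hG.le_iff (hF _ hg₁) (hF _ hg)).mp (hmin g hg hlt))) (hdist g hg g₁ hg₁)
    have h2 : d + (g.2 - g₁.2) = g.2 - y' := by rw [← hy']; abel
    rw [h2] at h1
    exact ⟨sub_pos.mp h1.1, by rw [c.v_sub_comm]; exact hpos h1⟩
  have hdown : ∀ (y' : V) (d : V), 0 < d → c.psi d = x' → ∀ g₁ ∈ F, y' - g₁.2 = d →
      (∀ g ∈ F, g.1 < y → g.1 ≤ g₁.1) → ∀ g ∈ F, g.1 < y →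
      g.2 < y' ∧ c.v (y' - g.2) = (x' : V) := by
    intro y' d hd hdx g₁ hg₁ hy' hmax g hg hlt
    have h1 := psi_add_of_nonneg hd hdx (sub_nonneg.mpr
      ((hG.le_iff (hF _ hg) (hF _ hg₁)).mp (hmax g hg hlt))) (hdist g₁ hg₁ g hg)
    have h2 : d + (g₁.2 - g.2) = y' - g.2 := by rw [← hy']; abel
    rw [h2] at h1
    exact ⟨sub_pos.mp h1.1, hpos h1⟩
  have finish : ∀ y', (∀ g ∈ F, y < g.1 → y' < g.2 ∧ c.v (y' - g.2) = (x' : V)) →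
      (∀ g ∈ F, g.1 < y → g.2 < y' ∧ c.v (y' - g.2) = (x' : V)) →
      ∀ g ∈ F, (y < g.1 ↔ y' < g.2) ∧ c.v (y' - g.2) = (x' : V) := by
    intro y' h1 h2 g hg
    rcases lt_or_gt_of_ne (hyne g hg) with h | h
    · exact ⟨iff_of_true h (h1 g hg h).1, (h1 g hg h).2⟩
    · exact ⟨iff_of_false h.not_gt (h2 g hg h).1.not_gt, (h2 g hg h).2⟩
  have hmax : (F.filter fun g => g.1 < y).Nonempty →
      ∃ g₁ ∈ F, g₁.1 < y ∧ ∀ g ∈ F, g.1 < y → g.1 ≤ g₁.1 := by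
    intro h
    obtain ⟨g₁, h1, h2⟩ := Finset.exists_max_image _ (fun g : V × V => g.1) h
    obtain ⟨h3, h4⟩ := Finset.mem_filter.mp h1
    exact ⟨g₁, h3, h4, fun g hg hlt => h2 g (Finset.mem_filter.mpr ⟨hg, hlt⟩)⟩
  have hmin : (F.filter fun g => y < g.1).Nonempty →
      ∃ g₁ ∈ F, y < g₁.1 ∧ ∀ g ∈ F, y < g.1 → g₁.1 ≤ g.1 := by
    intro h
    obtain ⟨g₁, h1, h2⟩ := Finset.exists_min_image _ (fun g : V × V => g.1) h
    obtain ⟨h3, h4⟩ := Finset.mem_filter.mp h1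
    exact ⟨g₁, h3, h4, fun g hg hlt => h2 g (Finset.mem_filter.mpr ⟨hg, hlt⟩)⟩
  rcases (F.filter fun g => g.1 < y).eq_empty_or_nonempty with hL | hL
  · have hL' : ∀ g ∈ F, ¬ g.1 < y := fun g hg h =>
      Finset.eq_empty_iff_forall_notMem.mp hL g (Finset.mem_filter.mpr ⟨hg, h⟩)
    obtain ⟨g, hg⟩ := hne
    obtain ⟨g₁, hg₁, -, h2⟩ := hmin ⟨g, Finset.mem_filter.mpr
      ⟨hg, lt_of_le_of_ne (not_lt.mp (hL' g hg)) (hyne g hg)⟩⟩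
    refine ⟨g₁.2 - (x' - c.p x'), Submodule.sub_mem _ (hran g₁ hg₁) heran, finish _
      (hup _ _ he1 he2 g₁ hg₁ (by abel) h2) fun g hg h => absurd h (hL' g hg)⟩
  obtain ⟨g₁, hg₁, hy₁, h1⟩ := hmax hL
  rcases (F.filter fun g => y < g.1).eq_empty_or_nonempty with hR | hR
  · have hR' : ∀ g ∈ F, ¬ y < g.1 := fun g hg h =>
      Finset.eq_empty_iff_forall_notMem.mp hR g (Finset.mem_filter.mpr ⟨hg, h⟩)
    refine ⟨g₁.2 + (x' - c.p x'), Submodule.add_mem _ (hran g₁ hg₁) heran, finish _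
      (fun g hg h => absurd h (hR' g hg)) (hdown _ _ he1 he2 g₁ hg₁ (by abel) h1)⟩
  obtain ⟨g₂, hg₂, hy₂, h2⟩ := hmin hR
  have hlt : 0 < g₂.2 - g₁.2 := sub_pos.mpr
    ((hG.lt_iff (hF _ hg₁) (hF _ hg₂)).mp (hy₁.trans hy₂))
  -- Between the two neighbours of the cut the midpoint works. As `y` lies between them at value `x`
  -- from each, they differ by value exactly `x`, and halving does not change the value.
  have hval : c.psi (g₂.2 - g₁.2) = x' := by
    have h3 : (g₂.1 - g₁.1, g₂.2 - g₁.2) ∈ G := G.sub_mem (hF _ hg₂) (hF _ hg₁)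
    have h4 : c.psi (g₂.1 - g₁.1) ≤ x := by
      rw [← (c.v_eq_coe.mp (hv g₁ hg₁)).2]
      exact c.psi_anti _ _ (sub_pos.mpr hy₁) (sub_le_sub_right hy₂.le _)
    refine le_antisymm ((hG.le_iff (hG.psi' h3) hxG).mp h4) ?_
    have := hdist _ hg₂ _ hg₁
    rw [c.v_of_ne hlt.ne'] at this
    exact_mod_cast this
  have hd : 0 < (1 / 2 : ℚ) • (g₂.2 - g₁.2) := rat_smul_pos (by norm_num) hlt
  have hd' : c.psi ((1 / 2 : ℚ) • (g₂.2 - g₁.2)) = x' := by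
    rw [c.psi_smul _ _ (by norm_num), hval]
  refine ⟨g₁.2 + (1 / 2 : ℚ) • (g₂.2 - g₁.2), Submodule.add_mem _ (hran _ hg₁)
    (Submodule.smul_mem _ _ (Submodule.sub_mem _ (hran _ hg₂) (hran _ hg₁))),
    finish _ (hup _ _ hd hd' g₂ hg₂ ?_ h2) (hdown _ _ hd hd' g₁ hg₁ (by abel) h1)⟩
  module

/-- Only the points nearest to `y`, those with `ψ (y - g)` maximal, need care; they are treated by
`exists_same_value`. For any other `g` and a nearest `g₀`, the element `y - g` has the same value
and sign as `g₀ - g`, and this is transported by `G`. -/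
theorem exists_elem_finite (hG : c.PIso G) {y : V} (hyG : y ∉ G.map (LinearMap.fst ℚ V V))
    (hψ : ∀ a ∈ G.map (LinearMap.fst ℚ V V), c.psi (y - a) ∈ G.map (LinearMap.fst ℚ V V))
    (F : Finset (V × V)) (hF : ∀ g ∈ F, g ∈ G) :
    ∃ y' ∈ G.map (LinearMap.snd ℚ V V), ∀ g ∈ F,
      (y < g.1 ↔ y' < g.2) ∧ y' ≠ g.2 ∧ (c.psi (y - g.1), c.psi (y' - g.2)) ∈ G := by
  classical
  rcases F.eq_empty_or_nonempty with rfl | hne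
  · exact ⟨0, Submodule.zero_mem _, by simp⟩
  have hyne : ∀ g ∈ F, y - g.1 ≠ 0 := fun g hg h =>
    hyG (sub_eq_zero.mp h ▸ PIso.mem_dom.mpr ⟨g.2, hF g hg⟩)
  obtain ⟨g₀, hg₀, hmax⟩ := Finset.exists_max_image F (fun g => c.psi (y - g.1)) hne
  obtain ⟨x', hx'⟩ := PIso.mem_dom.mp (hψ g₀.1 (PIso.mem_dom.mpr ⟨g₀.2, hF _ hg₀⟩))
  set x := c.psi (y - g₀.1) with hx
  obtain ⟨y', hy', h⟩ := exists_same_value hG hx' (c.psi_mem _ (hyne _ hg₀)) (y := y)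
    (F.filter fun g => c.psi (y - g.1) = x) (fun g hg => hF g (Finset.mem_filter.mp hg).1)
    (fun g hg => by
      obtain ⟨h1, h2⟩ := Finset.mem_filter.mp hg
      rw [c.v_of_ne (hyne g h1), h2])
    ⟨g₀, Finset.mem_filter.mpr ⟨hg₀, rfl⟩⟩
  refine ⟨y', hy', fun g hg => ?_⟩
  have hv₀ := (h g₀ (Finset.mem_filter.mpr ⟨hg₀, rfl⟩)).2
  rcases (hmax g hg).eq_or_lt with h1 | h1
  · obtain ⟨h2, h3⟩ := h g (Finset.mem_filter.mpr ⟨hg, h1⟩)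
    obtain ⟨h4, h5⟩ := c.v_eq_coe.mp h3
    exact ⟨h2, sub_ne_zero.mp h4, by rw [h1, h5]; exact hx'⟩
  · have hgg : (g₀.1 - g.1, g₀.2 - g.2) ∈ G := G.sub_mem (hF _ hg₀) (hF _ hg)
    have hv1 : c.v (y - g.1) < c.v (-(y - g₀.1)) := by
      rw [c.v_neg, c.v_of_ne (hyne g hg), c.v_of_ne (hyne g₀ hg₀)]
      exact_mod_cast h1
    have he1 : g₀.1 - g.1 = (y - g.1) + -(y - g₀.1) := by abel
    have hv2 : c.v (g₀.1 - g.1) = (c.psi (y - g.1) : V) := by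
      rw [he1, c.v_add_of_lt hv1, c.v_of_ne (hyne g hg)]
    obtain ⟨hne1, hpsi1⟩ := c.v_eq_coe.mp hv2
    have hne2 := (hG.zero_iff hgg).not.mp hne1
    have hpsi2 := hG.psi' hgg
    rw [hpsi1] at hpsi2
    have hv3 : c.v (g₀.2 - g.2) < c.v (y' - g₀.2) := by
      rw [hv₀, c.v_of_ne hne2]
      exact_mod_cast (hG.lt_iff hpsi2 hx').mp h1
    have he2 : y' - g.2 = (g₀.2 - g.2) + (y' - g₀.2) := by abel
    have hv4 : c.v (y' - g.2) = (c.psi (g₀.2 - g.2) : V) := by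
      rw [he2, c.v_add_of_lt hv3, c.v_of_ne hne2]
    obtain ⟨hne3, hpsi3⟩ := c.v_eq_coe.mp hv4
    refine ⟨?_, sub_ne_zero.mp hne3, by rw [hpsi3]; exact hpsi2⟩
    have hs1 : 0 < y - g.1 ↔ 0 < y' - g.2 := by
      rw [he2, c.pos_add_iff_of_lt hv3, ← hG.pos hgg, he1, c.pos_add_iff_of_lt hv1]
    rw [sub_pos, sub_pos] at hs1
    constructor
    · intro h2
      exact lt_of_le_of_ne (not_lt.mp (hs1.not.mp h2.not_gt)) (sub_ne_zero.mp hne3)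
    · intro h2
      exact lt_of_le_of_ne (not_lt.mp (hs1.not.mpr h2.not_gt)) (sub_ne_zero.mp (hyne g hg))

/-- The hypothesis on `ψ (y - a)` says that `y` creates no new values, so the value required of `z -
b` is the image under `G` of a known element. As for `Ψ`, finite solutions come from the range and
hence `C` can be avoided. -/
theorem exists_elem (hsat : c.IsSaturated) (hG : c.PIso G) [Countable G]
    (hC : (C : Set V).Countable) {y : V} (hyG : y ∉ G.map (LinearMap.fst ℚ V V))
    (hψ : ∀ a ∈ G.map (LinearMap.fst ℚ V V), c.psi (y - a) ∈ G.map (LinearMap.fst ℚ V V)) :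
    ∃ y', (∀ d ∈ C, y' ≠ d) ∧ ∀ a b, (a, b) ∈ G →
      (y < a ↔ y' < b) ∧ y' ≠ b ∧ (c.psi (y - a), c.psi (y' - b)) ∈ G := by
  classical
  have : Countable C := hC.to_subtype
  have hf : ∀ g : G, ∃ z, (c.psi (y - g.1.1), z) ∈ G := fun g =>
    PIso.mem_dom.mp (hψ _ (PIso.mem_dom.mpr ⟨_, g.2⟩))
  choose f hf using hf
  let P : G ⊕ {d : C // d.1 ∉ G.map (LinearMap.snd ℚ V V)} → V → Prop := Sum.elim
    (fun g z => (y < g.1.1 ↔ z < g.1.2) ∧ (¬ z = g.1.2 ∧ c.psi (z - g.1.2) = f g))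
    (fun d z => ¬ z = d.1.1)
  obtain ⟨z, hz⟩ := hsat.exists_of_countable P
    (by
      rintro (g | d)
      · exact .and (.iff_const (.lt _) _) (.and (.not (.eq _)) (.psi _ _))
      · exact .not (.eq _))
    (fun F => by
      obtain ⟨z, hz1, hz2⟩ := exists_elem_finite hG hyG hψ (F.toLeft.image Subtype.val)
        (fun g hg => by
          obtain ⟨g, -, rfl⟩ := Finset.mem_image.mp hg
          exact g.2)
      refine ⟨z, ?_⟩
      rintro (g | d) hF
      · obtain ⟨h1, h2, h3⟩ := hz2 g (Finset.mem_image_of_mem _ (Finset.mem_toLeft.mpr hF))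
        exact ⟨h1, h2, (hG.eq_iff h3 (hf g)).mp rfl⟩
      · exact fun h => d.2 (h ▸ hz1))
  have hz' : ∀ a b, (a, b) ∈ G →
      (y < a ↔ z < b) ∧ z ≠ b ∧ (c.psi (y - a), c.psi (z - b)) ∈ G := by
    intro a b hab
    obtain ⟨h1, h2, h3⟩ := hz (Sum.inl ⟨(a, b), hab⟩)
    refine ⟨h1, h2, ?_⟩
    have h4 := hf ⟨(a, b), hab⟩
    rw [← h3] at h4
    exact h4
  refine ⟨z, fun d hd h => ?_, hz'⟩
  by_cases hr : d ∈ G.map (LinearMap.snd ℚ V V)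
  · obtain ⟨a, ha⟩ := PIso.mem_ran.mp hr
    exact (hz' a d ha).2.1 h
  · exact hz (Sum.inr ⟨⟨d, hd⟩, hr⟩) h

end

end LogCouple

/-! ### Adjoining an element without new values, and the extension theorem. -/

namespace LogCouple

variable {V : Type*} [AddCommGroup V] [LinearOrder V] [IsOrderedAddMonoid V] [Module ℚ V]
  {c : LogCouple V}

open IsPsiChain

/-- The graph `G` extended by the pair `(y, z)`. -/
def addElem (G : Submodule ℚ (V × V)) (y z : V) : Submodule ℚ (V × V) :=
  G ⊔ Submodule.span ℚ {(y, z)}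

theorem mem_addElem {G : Submodule ℚ (V × V)} {y z α β : V} :
    (α, β) ∈ addElem G y z ↔ ∃ a b, ∃ q : ℚ, (a, b) ∈ G ∧ α = a + q • y ∧ β = b + q • z := by
  rw [addElem, Submodule.mem_sup]
  constructor
  · rintro ⟨⟨a, b⟩, hab, w, hw, h⟩
    obtain ⟨q, rfl⟩ := Submodule.mem_span_singleton.mp hw
    simp only [Prod.smul_mk, Prod.mk_add_mk, Prod.mk.injEq] at h
    exact ⟨a, b, q, hab, h.1.symm, h.2.symm⟩
  · rintro ⟨a, b, q, hab, rfl, rfl⟩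
    exact ⟨(a, b), hab, _, Submodule.mem_span_singleton.mpr ⟨q, rfl⟩, rfl⟩

theorem le_addElem (G : Submodule ℚ (V × V)) (y z : V) : G ≤ addElem G y z := le_sup_left

theorem elem_mem_addElem (G : Submodule ℚ (V × V)) (y z : V) : (y, z) ∈ addElem G y z :=
  (le_sup_right : _ ≤ addElem G y z) (Submodule.mem_span_singleton_self _)

section

variable {G : Submodule ℚ (V × V)} {y z : V}

theorem add_smul_eq {q : ℚ} (hq : q ≠ 0) (a y : V) : a + q • y = q • (y - -(q⁻¹ • a)) := by
  rw [sub_neg_eq_add, smul_add, smul_inv_smul₀ hq, add_comm]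

theorem addElem_pos (hG : c.PIso G) (hyG : y ∉ G.map (LinearMap.fst ℚ V V))
    (hz : ∀ a b, (a, b) ∈ G → (y < a ↔ z < b) ∧ z ≠ b ∧ (c.psi (y - a), c.psi (z - b)) ∈ G)
    {α β : V} (h : (α, β) ∈ addElem G y z) :
    (0 < α ↔ 0 < β) ∧ (α = 0 ↔ β = 0) ∧ (c.psi α, c.psi β) ∈ G := by
  obtain ⟨a, b, q, hab, rfl, rfl⟩ := mem_addElem.mp h
  by_cases hq : q = 0
  · simpa [hq] using ⟨hG.pos hab, hG.zero_iff hab, hG.psi' hab⟩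
  have hab' : (-(q⁻¹ • a), -(q⁻¹ • b)) ∈ G := G.neg_mem (G.smul_mem q⁻¹ hab)
  obtain ⟨h1, h2, h3⟩ := hz _ _ hab'
  have hy : y ≠ -(q⁻¹ • a) := fun h => hyG (h ▸ PIso.mem_dom.mpr ⟨_, hab'⟩)
  rw [add_smul_eq hq, add_smul_eq hq, c.psi_smul _ _ hq, c.psi_smul _ _ hq]
  refine ⟨?_, ?_, h3⟩
  · rcases lt_or_gt_of_ne hq with h | h
    · have hneg : ∀ w : V, 0 < q • w ↔ w < 0 := fun w => by
        rw [← neg_smul_neg, rat_smul_pos_iff (neg_pos.mpr h), neg_pos]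
      rw [hneg, hneg, sub_neg, sub_neg, h1]
    · rw [rat_smul_pos_iff h, rat_smul_pos_iff h, sub_pos, sub_pos]
      constructor
      · intro h4
        exact lt_of_le_of_ne (not_lt.mp (h1.not.mp h4.not_gt)) h2.symm
      · intro h4
        exact lt_of_le_of_ne (not_lt.mp (h1.not.mpr h4.not_gt)) hy.symm
  · rw [smul_eq_zero_iff_right hq, smul_eq_zero_iff_right hq, sub_eq_zero, sub_eq_zero]
    exact iff_of_false hy h2

/-- For `s`, let `w` correspond to `s (a + q • y)`. Transporting `ψ (α - s α) = s α` gives `ψ (β -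
w) = w` for the partner `β`, and this equation with `w ∈ Ψ` forces `s β = w`. -/
theorem PIso.addElem (hG : c.PIso G) (hyG : y ∉ G.map (LinearMap.fst ℚ V V))
    (hs : ∀ a ∈ G.map (LinearMap.fst ℚ V V), ∀ q : ℚ,
      c.s (a + q • y) ∈ G.map (LinearMap.fst ℚ V V))
    (hz : ∀ a b, (a, b) ∈ G → (y < a ↔ z < b) ∧ z ≠ b ∧ (c.psi (y - a), c.psi (z - b)) ∈ G) :
    c.PIso (addElem G y z) where
  pos h := (addElem_pos hG hyG hz h).1
  psi h k := le_addElem _ _ _ (hG.iterate_p_mem (addElem_pos hG hyG hz h).2.2 k)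
  s {α β} h := by
    obtain ⟨a, b, q, hab, rfl, rfl⟩ := mem_addElem.mp h
    obtain ⟨w, hw⟩ := mem_dom.mp (hs a (mem_dom.mpr ⟨_, hab⟩) q)
    have h1 : (a + q • y - c.s (a + q • y), b + q • z - w) ∈ LogCouple.addElem G y z :=
      Submodule.sub_mem _ h (le_addElem _ _ _ hw)
    obtain ⟨-, h2, h3⟩ := addElem_pos hG hyG hz h1
    rw [c.psi_sub_s] at h3
    have h4 : w = c.psi (b + q • z - w) := (hG.eq_iff hw h3).mp rfl
    have h5 : b + q • z - w ≠ 0 := h2.not.mp (sub_ne_zero.mpr (c.ne_s _))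
    have h6 := c.s_eq_of_v_sub (hG.mem_Psi hw (c.s_mem _)) (c.v_eq_coe.mpr ⟨h5, h4.symm⟩) le_rfl
    rw [h6]
    exact le_addElem _ _ _ hw

theorem mem_of_addElem {C : Submodule ℚ V} (hGC : G.map (LinearMap.snd ℚ V V) ≤ C) (hzC : z ∉ C)
    {α β : V} (h : (α, β) ∈ addElem G y z) (hβ : β ∈ C) : (α, β) ∈ G := by
  obtain ⟨a, b, q, hab, rfl, rfl⟩ := mem_addElem.mp h
  by_cases hq : q = 0
  · simpa [hq] using hab
  · refine absurd ?_ hzC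
    have h1 := C.smul_mem q⁻¹ (C.sub_mem hβ (hGC (PIso.mem_ran.mpr ⟨_, hab⟩)))
    rwa [add_sub_cancel_left, inv_smul_smul₀ hq] at h1

end

theorem comb_mem {D : Submodule ℚ V} {x : ℤ → V} (h : ∀ k, x k ∈ D) (q : ℤ →₀ ℚ) :
    comb x q ∈ D := by
  rw [comb, Finsupp.linearCombination_apply]
  exact Submodule.sum_mem _ fun k _ => D.smul_mem _ (h k)

theorem IsClosed.chain_mem {D : Submodule ℚ V} (hD : c.IsClosed D) {x : V} (hx : x ∈ D) (k : ℤ) :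
    chain c x k ∈ D := by
  have hs : ∀ n : ℕ, c.s^[n] x ∈ D := by
    intro n
    induction n with
    | zero => exact hx
    | succ n ih => rw [Function.iterate_succ_apply']; exact hD.s ih
  have hp : ∀ n : ℕ, c.p^[n] x ∈ D := by
    intro n
    induction n with
    | zero => exact hx
    | succ n ih => rw [Function.iterate_succ_apply']; exact hD.p ih
  rcases k with n | n
  · exact hs n
  · exact hp (n + 1)

theorem PIso.countable {G : Submodule ℚ (V × V)} (hG : c.PIso G) {D : Submodule ℚ V}
    (hD : (D : Set V).Countable) (h : G.map (LinearMap.fst ℚ V V) ≤ D) : Countable G := by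
  have : Countable D := hD.to_subtype
  refine Function.Injective.countable
    (f := fun g : G => (⟨g.1.1, h (mem_dom.mpr ⟨g.1.2, g.2⟩)⟩ : D)) ?_
  rintro ⟨⟨a, b⟩, hg⟩ ⟨⟨a', b'⟩, hg'⟩ h1
  simp only [Subtype.mk.injEq] at h1
  subst h1
  obtain rfl := (hG.eq_iff hg hg').mp rfl
  rfl

/-- Every isomorphism between countable closed subspaces extends to any larger countable closed
subspace `D`, in such a way that no new value lies in `C`. -/
theorem PIso.exists_extension (hsat : c.IsSaturated) {G : Submodule ℚ (V × V)} (hG : c.PIso G)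
    {C D : Submodule ℚ V} (hD : c.IsClosed D) (hDc : (D : Set V).Countable)
    (hGD : G.map (LinearMap.fst ℚ V V) ≤ D) (hCc : (C : Set V).Countable) :
    ∃ H, c.PIso H ∧ G ≤ H ∧ H.map (LinearMap.fst ℚ V V) = D ∧
      ∀ a b, (a, b) ∈ H → b ∈ C → (a, b) ∈ G := by
  let S : Set (Submodule ℚ (V × V)) := {H | c.PIso H ∧ G ≤ H ∧ H.map (LinearMap.fst ℚ V V) ≤ D ∧
      ∀ a b, (a, b) ∈ H → b ∈ C → (a, b) ∈ G}
  obtain ⟨H, hGH, ⟨hH, -, hHD, hHC⟩, hmax⟩ := zorn_le_nonempty₀ S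
    (by
      intro T hTS hT H₀ hH₀
      have hmem : ∀ z, z ∈ sSup T ↔ ∃ H ∈ T, z ∈ H := fun z =>
        Submodule.mem_sSup_of_directed ⟨H₀, hH₀⟩ hT.directedOn
      refine ⟨sSup T, ⟨⟨fun h => ?_, fun h k => ?_, fun h => ?_⟩, ?_, ?_, ?_⟩,
        fun H hH => le_sSup hH⟩
      · obtain ⟨H, hH, h1⟩ := (hmem _).mp h
        exact (hTS hH).1.pos h1
      · obtain ⟨H, hH, h1⟩ := (hmem _).mp h
        exact (hmem _).mpr ⟨H, hH, (hTS hH).1.psi h1 k⟩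
      · obtain ⟨H, hH, h1⟩ := (hmem _).mp h
        exact (hmem _).mpr ⟨H, hH, (hTS hH).1.s h1⟩
      · exact (hTS hH₀).2.1.trans (le_sSup hH₀)
      · intro a ha
        obtain ⟨b, hb⟩ := mem_dom.mp ha
        obtain ⟨H, hH, h1⟩ := (hmem _).mp hb
        exact (hTS hH).2.2.1 (mem_dom.mpr ⟨b, h1⟩)
      · intro a b h hb
        obtain ⟨H, hH, h1⟩ := (hmem _).mp h
        exact (hTS hH).2.2.2 a b h1 hb)
    G ⟨hG, le_rfl, hGD, fun _ _ h _ => h⟩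
  refine ⟨H, hH, hGH, le_antisymm hHD ?_, hHC⟩
  have := hH.countable hDc hHD
  have hranc : ((H.map (LinearMap.snd ℚ V V) : Submodule ℚ V) : Set V).Countable := by
    rw [Submodule.map_coe]
    exact (Set.to_countable (H : Set (V × V))).image _
  -- A new value is chosen outside a closed `E` containing both `C` and the range; then no
  -- nontrivial combination with elements of the range falls into `C`.
  obtain ⟨E, hE, hEc, hES⟩ := exists_isClosed c _ (hCc.union hranc)
  have hCE : ∀ b ∈ C, b ∈ E := fun b hb => hES (Or.inl hb)
  have hHE : H.map (LinearMap.snd ℚ V V) ≤ E := fun b hb => hES (Or.inr hb)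
  -- A maximal isomorphism already has all of `D ∩ Ψ` in its domain, as otherwise a chain could be
  -- adjoined.
  have hPsi : ∀ x ∈ D, x ∈ c.Psi → x ∈ H.map (LinearMap.fst ℚ V V) := by
    intro x hxD hx
    by_contra hxH
    obtain ⟨y, hy, hyE, hcut⟩ := exists_Psi hsat hH hEc hxH hx
    have hxc := hH.isClosed_dom.isPsiChain hx hxH
    have hycE := hE.isPsiChain hy hyE
    have hyc := hH.isClosed_ran.isPsiChain hy (fun h => hyE (hHE h))
    have hle := hmax (y := LogCouple.addChain H (chain c x) (chain c y))
      ⟨hH.addChain hxc hyc hcut, hGH.trans (le_addChain _ _ _), ?_, ?_⟩ (le_addChain _ _ _)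
    · exact hxH (mem_dom.mpr ⟨y, hle (chain_mem_addChain H (chain c x) (chain c y) 0)⟩)
    · intro α hα
      obtain ⟨β, hβ⟩ := mem_dom.mp hα
      obtain ⟨a, b, q, hab, rfl, -⟩ := mem_addChain.mp hβ
      exact D.add_mem (hHD (mem_dom.mpr ⟨_, hab⟩)) (comb_mem (hD.chain_mem hxD) q)
    · intro α β h hβ
      exact hHC _ _ (mem_of_addChain hE hHE hycE h (hCE _ hβ)) hβ
  intro y hyD
  by_contra hyH
  -- Once `D ∩ Ψ` is in the domain, a remaining element `y` of `D` yields no new values of `ψ` or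
  -- `s`, so it can be adjoined alone.
  have hψ : ∀ a ∈ H.map (LinearMap.fst ℚ V V), c.psi (y - a) ∈ H.map (LinearMap.fst ℚ V V) :=
    fun a ha => hPsi _ (hD.psi (D.sub_mem hyD (hHD ha)))
      (c.psi_mem _ (sub_ne_zero.mpr fun h => hyH (h ▸ ha)))
  have hs : ∀ a ∈ H.map (LinearMap.fst ℚ V V), ∀ q : ℚ,
      c.s (a + q • y) ∈ H.map (LinearMap.fst ℚ V V) :=
    fun a ha q => hPsi _ (hD.s (D.add_mem (hHD ha) (D.smul_mem _ hyD))) (c.s_mem _)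
  obtain ⟨z, hzE, hz⟩ := exists_elem hsat hH hEc hyH hψ
  have hle := hmax (y := LogCouple.addElem H y z)
    ⟨hH.addElem hyH hs hz, hGH.trans (le_addElem _ _ _), ?_, ?_⟩ (le_addElem _ _ _)
  · exact hyH (mem_dom.mpr ⟨z, hle (elem_mem_addElem H y z)⟩)
  · intro α hα
    obtain ⟨β, hβ⟩ := mem_dom.mp hα
    obtain ⟨a, b, q, hab, rfl, -⟩ := mem_addElem.mp hβ
    exact D.add_mem (hHD (mem_dom.mpr ⟨_, hab⟩)) (D.smul_mem _ hyD)
  · intro α β h hβ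
    exact hHC _ _ (mem_of_addElem hHE (fun h => hzE _ h rfl) h (hCE _ hβ)) hβ

end LogCouple

/-! ### From a model of `T_log` to a `LogCouple`. -/

namespace AsymptoticCouple

section

variable {Γ : Type*} [AddCommGroup Γ] [LinearOrder Γ] [IsOrderedAddMonoid Γ] [AsymptoticCouple Γ]

/-- `ψ` with values in `Γ`. -/
noncomputable def psiFin (a : Γ) : Γ := (psi a).untopD 0

/-- `s` with values in `Γ`. -/
noncomputable def succFin (a : Γ) : Γ := (succ (a : WithTop Γ)).untopD 0

variable (Γ) in
/-- `Ψ` as a subset of `Γ`. -/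
def PsiFin : Set Γ := {x | (x : WithTop Γ) ∈ Psi Γ}

open Classical in
/-- `p` with values in `Γ`, set to `0` outside `Ψ^{> s0}`. -/
noncomputable def predFin (x : Γ) : Γ :=
  if x ∈ PsiFin Γ ∧ x ≠ succFin 0 then (pred (x : WithTop Γ)).untopD 0 else 0

theorem coe_untopD {α : Type*} [Zero α] {x : WithTop α} (h : x ≠ ⊤) :
    ((x.untopD 0 : α) : WithTop α) = x := by
  obtain ⟨y, rfl⟩ := WithTop.ne_top_iff_exists.mp h
  rfl

theorem coe_psiFin {a : Γ} (h : a ≠ 0) : ((psiFin a : Γ) : WithTop Γ) = psi a :=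
  coe_untopD ((psi_eq_top_iff a).not.mpr h)

theorem psiFin_zero : psiFin (0 : Γ) = 0 := by
  rw [psiFin, (psi_eq_top_iff (0 : Γ)).mpr rfl]
  rfl

theorem psiFin_mem {a : Γ} (h : a ≠ 0) : psiFin a ∈ PsiFin Γ := ⟨a, h, (coe_psiFin h).symm⟩

theorem psiFin_zsmul (r : ℤ) (a : Γ) (hr : r ≠ 0) : psiFin (r • a) = psiFin a := by
  by_cases h : a = 0
  · simp [h]
  · rw [psiFin, psiFin, ac2 r a hr h]

theorem psiFin_neg (a : Γ) : psiFin (-a) = psiFin a := by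
  simpa using psiFin_zsmul (-1) a (by norm_num)

theorem psiFin_add (a b x : Γ) (ha : a ≠ 0) (hb : b ≠ 0) (hab : a + b ≠ 0) (h : x ≤ psiFin a)
    (h' : x ≤ psiFin b) : x ≤ psiFin (a + b) := by
  have := ac1 a b ha hb hab
  rw [← coe_psiFin ha, ← coe_psiFin hb, ← coe_psiFin hab] at this
  exact (le_min h h').trans (by exact_mod_cast this)

theorem psiFin_add_eq {a b : Γ} (ha : a ≠ 0) (hb : b ≠ 0) (h : psiFin a < psiFin b) :
    a + b ≠ 0 ∧ psiFin (a + b) = psiFin a := by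
  have h0 : a + b ≠ 0 := by
    intro h0
    rw [← psiFin_neg b, ← eq_neg_of_add_eq_zero_left h0] at h
    exact lt_irrefl _ h
  refine ⟨h0, le_antisymm ?_ (psiFin_add a b _ ha hb h0 le_rfl h.le)⟩
  by_contra h'
  rw [not_le] at h'
  have h1 := psiFin_add (a + b) (-b) (min (psiFin (a + b)) (psiFin b)) h0 (neg_ne_zero.mpr hb)
    (by simpa using ha) (min_le_left _ _) (by rw [psiFin_neg]; exact min_le_right _ _)
  rw [add_neg_cancel_right] at h1
  exact absurd (lt_min h' h) (not_lt.mpr h1)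

/-- If `ψ a < ψ b` then `ψ b - ψ a` has value greater than `ψ a`. -/
theorem lt_psiFin_sub (hH : IsHType Γ) {a b : Γ} (ha : a ≠ 0) (hb : b ≠ 0)
    (h : psiFin a < psiFin b) : psiFin a < psiFin (psiFin b - psiFin a) := by
  have hac3 : ∀ e : Γ, 0 < e → psiFin b < e + psiFin e := by
    intro e he
    have := ac3 e b he hb
    rw [← coe_psiFin hb, ← coe_psiFin he.ne'] at this
    exact_mod_cast this
  have hd : 0 < psiFin b - psiFin a := sub_pos.mpr h
  have habs : 0 < |a| := abs_pos.mpr ha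
  have hpa : psiFin |a| = psiFin a := by
    rcases abs_choice a with h1 | h1 <;> rw [h1]
    exact psiFin_neg a
  -- (AC3) bounds the difference by `|a|`, so the `H`-type condition gives the weak inequality;
  -- equality would contradict (AC3) for the difference itself.
  have h1 : psiFin b - psiFin a ≤ |a| := by
    have := hac3 _ habs
    rw [hpa] at this
    exact (sub_lt_iff_lt_add.mpr this).le
  have h2 := hH _ _ hd h1
  rw [← coe_psiFin habs.ne', ← coe_psiFin hd.ne', hpa] at h2
  refine lt_of_le_of_ne (by exact_mod_cast h2) fun h3 => ?_
  have := hac3 _ hd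
  rw [← h3, sub_add_cancel] at this
  exact lt_irrefl _ this

theorem integral_spec (hI : HasAsymptoticIntegration Γ) (a : Γ) :
    integral a ≠ 0 ∧ integral a + psiFin (integral a) = a ∧
      (succ (a : WithTop Γ)) = psi (integral a) := by
  have h : integral a ≠ 0 ∧ ((integral a : Γ) : WithTop Γ) + psi (integral a) = a := by
    have := hI a
    rw [integral, dif_pos this]
    exact this.choose_spec
  refine ⟨h.1, ?_, rfl⟩
  have h2 := h.2
  rw [← coe_psiFin h.1] at h2
  exact_mod_cast h2

theorem succ_coe (hI : HasAsymptoticIntegration Γ) (a : Γ) :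
    succ (a : WithTop Γ) = ((succFin a : Γ) : WithTop Γ) := by
  obtain ⟨h1, -, h3⟩ := integral_spec hI a
  rw [succFin, coe_untopD]
  rw [h3, ← coe_psiFin h1]
  exact WithTop.coe_ne_top

theorem sub_succFin (hI : HasAsymptoticIntegration Γ) (a : Γ) :
    a - succFin a ≠ 0 ∧ psiFin (a - succFin a) = succFin a := by
  obtain ⟨h1, h2, h3⟩ := integral_spec hI a
  have h4 : succFin a = psiFin (integral a) := by rw [succFin, h3, psiFin]
  have h5 : a - succFin a = integral a := by rw [h4, sub_eq_iff_eq_add, h2]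
  rw [h5]
  exact ⟨h1, h4.symm⟩

theorem exists_coe_of_mem_Psi {z : WithTop Γ} (hz : z ∈ Psi Γ) : ∃ x ∈ PsiFin Γ, z = (x : Γ) := by
  obtain ⟨g, hg, rfl⟩ := hz
  exact ⟨psiFin g, psiFin_mem hg, (coe_psiFin hg).symm⟩

end

section

variable {Γ : Type*} [AddCommGroup Γ] [LinearOrder Γ] [IsOrderedAddMonoid Γ] [Module ℚ Γ]
  [AsymptoticCouple Γ]

theorem IsModelTlog.succ_coe (h : IsModelTlog Γ) (a : Γ) :
    succ (a : WithTop Γ) = ((succFin a : Γ) : WithTop Γ) :=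
  AsymptoticCouple.succ_coe h.asymptoticIntegration a

theorem IsModelTlog.mem_PsiGt_iff (h : IsModelTlog Γ) {x : Γ} :
    (x : WithTop Γ) ∈ PsiGt Γ ↔ x ∈ PsiFin Γ ∧ x ≠ succFin 0 := by
  rw [PsiGt, Set.mem_ofPred_eq, h.succ_coe]
  refine and_congr_right fun hx => ?_
  have := h.isLeast_succ_zero.2 hx
  rw [h.succ_coe] at this
  rw [WithTop.coe_lt_coe]
  exact ⟨fun h => h.ne', fun h => lt_of_le_of_ne (by exact_mod_cast this) h.symm⟩

theorem IsModelTlog.pred_coe (h : IsModelTlog Γ) {x : Γ} (hx : x ∈ PsiFin Γ ∧ x ≠ succFin 0) :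
    pred (x : WithTop Γ) = ((predFin x : Γ) : WithTop Γ) ∧ predFin x ∈ PsiFin Γ ∧
      succFin (predFin x) = x := by
  have h1 := h.mem_PsiGt_iff.mpr hx
  have h2 : (x : WithTop Γ) ∈ PsiGt Γ ∧ ∃ z ∈ Psi Γ, succ z = (x : WithTop Γ) :=
    ⟨h1, h.bijOn_succ.surjOn h1⟩
  have h3 : pred (x : WithTop Γ) ∈ Psi Γ ∧ succ (pred (x : WithTop Γ)) = x := by
    rw [pred, dif_pos h2]
    exact h2.2.choose_spec
  obtain ⟨y, hy, hyx⟩ := exists_coe_of_mem_Psi h3.1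
  have h4 : predFin x = y := by rw [predFin, if_pos hx, hyx]; rfl
  rw [h4, hyx]
  refine ⟨rfl, hy, ?_⟩
  have h5 := h3.2
  rw [hyx, h.succ_coe] at h5
  exact_mod_cast h5

theorem IsModelTlog.pred_eq_top (h : IsModelTlog Γ) {x : Γ} (hx : ¬ (x ∈ PsiFin Γ ∧ x ≠ succFin 0)) :
    pred (x : WithTop Γ) = ⊤ := by
  rw [pred, dif_neg]
  exact fun h1 => hx (h.mem_PsiGt_iff.mp h1.1)

/-- A model of `T_log` as a `LogCouple`. -/
noncomputable def IsModelTlog.logCouple (h : IsModelTlog Γ) : LogCouple Γ where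
  Psi := PsiFin Γ
  psi := psiFin
  s := succFin
  p := predFin
  psi_zero := psiFin_zero
  psi_mem a := psiFin_mem
  psi_add := psiFin_add
  psi_smul q a hq := by
    have h1 : (q.den : ℤ) • (q • a) = q.num • a := by
      rw [← Int.cast_smul_eq_zsmul ℚ, ← Int.cast_smul_eq_zsmul ℚ, smul_smul]
      congr 1
      push_cast
      exact Rat.den_mul_eq_num q
    rw [← psiFin_zsmul q.den (q • a) (by exact_mod_cast q.den_ne_zero), h1,
      psiFin_zsmul _ _ (Rat.num_ne_zero.mpr hq)]
  psi_anti a b ha hab := by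
    have := h.hType a b ha hab
    rw [← coe_psiFin ha.ne', ← coe_psiFin (ha.trans_le hab).ne'] at this
    exact_mod_cast this
  s_mem a := by
    obtain ⟨h1, h2⟩ := sub_succFin h.asymptoticIntegration a
    exact h2 ▸ psiFin_mem h1
  ne_s a := sub_ne_zero.mp (sub_succFin h.asymptoticIntegration a).1
  psi_sub_s a := (sub_succFin h.asymptoticIntegration a).2
  s_zero_le x hx := by
    have := h.isLeast_succ_zero.2 hx
    rw [h.succ_coe] at this
    exact_mod_cast this
  s_zero_pos := by
    have := h.succ_zero_pos
    rw [h.succ_coe] at this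
    exact_mod_cast this
  lt_s x hx := by
    have := (h.isLeast_succ x hx).1.2
    rw [h.succ_coe] at this
    exact_mod_cast this
  s_le x hx y hy hxy := by
    have := (h.isLeast_succ x hx).2 ⟨hy, by exact_mod_cast hxy⟩
    rw [h.succ_coe] at this
    exact_mod_cast this
  p_mem x hx hx0 := (h.pred_coe ⟨hx, hx0⟩).2.1
  s_p x hx hx0 := (h.pred_coe ⟨hx, hx0⟩).2.2
  p_zero x hx := by
    rw [predFin, if_neg]
    rintro ⟨h1, h2⟩
    exact hx.elim (fun h => h h1) h2
  psi_sub x hx y hy hxy := by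
    -- The decomposition is `y - x = -(x - s x) + (y - s y) + (s y - s x)`: the first term has value
    -- `s x`, the other two have larger values, the last by `lt_psiFin_sub`.
    obtain ⟨h1, h2⟩ := sub_succFin h.asymptoticIntegration x
    obtain ⟨h3, h4⟩ := sub_succFin h.asymptoticIntegration y
    have hlt : succFin x < succFin y := by
      have h5 := (h.isLeast_succ x hx).2 ⟨hy, by exact_mod_cast hxy⟩
      have h6 := (h.isLeast_succ y hy).1.2
      rw [h.succ_coe] at h5 h6
      exact_mod_cast h5.trans_lt h6
    obtain ⟨h5, h6⟩ := psiFin_add_eq (neg_ne_zero.mpr h1) h3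
      (by rw [psiFin_neg, h2, h4]; exact hlt)
    have h7 := lt_psiFin_sub h.hType h1 h3 (by rw [h2, h4]; exact hlt)
    rw [psiFin_neg, h2] at h6
    rw [h2, h4] at h7
    obtain ⟨-, h8⟩ := psiFin_add_eq h5 (sub_pos.mpr hlt).ne' (by rw [h6]; exact h7)
    rw [h6] at h8
    rw [← h8]
    congr 1
    abel

end

end AsymptoticCouple

/-! ### The ultrapower and its countable saturation. -/

namespace LogCouple

section Germ

variable {Γ : Type*} [AddCommGroup Γ] [LinearOrder Γ] [IsOrderedAddMonoid Γ] [Module ℚ Γ]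
  (c : LogCouple Γ)

variable (Γ) in
/-- The ultrapower of `Γ`. -/
abbrev UPow : Type _ := Germ (hyperfilter ℕ : Filter ℕ) Γ

theorem coe_ne_iff {f g : ℕ → Γ} :
    (f : UPow Γ) ≠ g ↔ ∀ᶠ n in (hyperfilter ℕ : Filter ℕ), f n ≠ g n := by
  rw [Ne, Germ.coe_eq, Filter.EventuallyEq, ← Ultrafilter.eventually_not]

theorem coe_zero_fun : ((fun _ => (0 : Γ) : ℕ → Γ) : UPow Γ) = 0 := rfl

theorem coe_ne_zero_iff {f : ℕ → Γ} :
    (f : UPow Γ) ≠ 0 ↔ ∀ᶠ n in (hyperfilter ℕ : Filter ℕ), f n ≠ 0 := by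
  rw [← coe_zero_fun, coe_ne_iff]

/-- The ultrapower of a `LogCouple`. -/
noncomputable def germ : LogCouple (UPow Γ) where
  Psi := {x | Germ.LiftPred (fun y => y ∈ c.Psi) x}
  psi := Germ.map c.psi
  s := Germ.map c.s
  p := Germ.map c.p
  psi_zero := by
    rw [← coe_zero_fun, Germ.map_coe, Germ.coe_eq]
    exact Eventually.of_forall fun n => c.psi_zero
  psi_mem a ha := by
    induction a using Germ.inductionOn with | _ a
    filter_upwards [coe_ne_zero_iff.mp ha] with n hn using c.psi_mem _ hn
  psi_add a b x ha hb hab h h' := by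
    induction a using Germ.inductionOn with | _ a
    induction b using Germ.inductionOn with | _ b
    induction x using Germ.inductionOn with | _ x
    rw [← Germ.coe_add] at hab ⊢
    filter_upwards [coe_ne_zero_iff.mp ha, coe_ne_zero_iff.mp hb, coe_ne_zero_iff.mp hab,
      Germ.coe_le.mp h, Germ.coe_le.mp h'] with n h1 h2 h3 h4 h5 using c.psi_add _ _ _ h1 h2 h3 h4 h5
  psi_smul q a hq := by
    induction a using Germ.inductionOn with | _ a
    rw [← Germ.coe_smul, Germ.map_coe, Germ.map_coe, Germ.coe_eq]
    exact Eventually.of_forall fun n => c.psi_smul q _ hq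
  psi_anti a b ha hab := by
    induction a using Germ.inductionOn with | _ a
    induction b using Germ.inductionOn with | _ b
    filter_upwards [Germ.coe_pos.mp ha, Germ.coe_le.mp hab] with n h1 h2 using c.psi_anti _ _ h1 h2
  s_mem a := by
    induction a using Germ.inductionOn with | _ a
    exact Eventually.of_forall fun n => c.s_mem _
  ne_s a := by
    induction a using Germ.inductionOn with | _ a
    exact coe_ne_iff.mpr (Eventually.of_forall fun n => c.ne_s _)
  psi_sub_s a := by
    induction a using Germ.inductionOn with | _ a
    rw [Germ.map_coe, ← Germ.coe_sub, Germ.map_coe, Germ.coe_eq]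
    exact Eventually.of_forall fun n => c.psi_sub_s _
  s_zero_le x hx := by
    induction x using Germ.inductionOn with | _ x
    filter_upwards [Germ.liftPred_coe.mp hx] with n h1 using c.s_zero_le _ h1
  s_zero_pos := Germ.coe_pos.mpr (Eventually.of_forall fun n => c.s_zero_pos)
  lt_s x hx := by
    induction x using Germ.inductionOn with | _ x
    rw [Germ.map_coe, Germ.coe_lt]
    filter_upwards [Germ.liftPred_coe.mp hx] with n h1 using c.lt_s _ h1
  s_le x hx y hy h := by
    induction x using Germ.inductionOn with | _ x
    induction y using Germ.inductionOn with | _ y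
    filter_upwards [Germ.liftPred_coe.mp hx, Germ.liftPred_coe.mp hy, Germ.coe_lt.mp h]
      with n h1 h2 h3 using c.s_le _ h1 _ h2 h3
  p_mem x hx hx0 := by
    induction x using Germ.inductionOn with | _ x
    rw [← coe_zero_fun, Germ.map_coe, coe_ne_iff] at hx0
    filter_upwards [Germ.liftPred_coe.mp hx, hx0] with n h1 h2 using c.p_mem _ h1 h2
  s_p x hx hx0 := by
    induction x using Germ.inductionOn with | _ x
    rw [← coe_zero_fun, Germ.map_coe, coe_ne_iff] at hx0
    rw [Germ.map_coe, Germ.map_coe, Germ.coe_eq]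
    filter_upwards [Germ.liftPred_coe.mp hx, hx0] with n h1 h2 using c.s_p _ h1 h2
  p_zero x hx := by
    induction x using Germ.inductionOn with | _ x
    rw [← coe_zero_fun, Germ.map_coe, Germ.coe_eq]
    rcases hx with hx | hx
    · rw [Set.mem_ofPred_eq, Germ.liftPred_coe, ← Ultrafilter.eventually_not] at hx
      filter_upwards [hx] with n h1 using c.p_zero _ (Or.inl h1)
    · rw [← coe_zero_fun, Germ.map_coe, Germ.coe_eq] at hx
      filter_upwards [hx] with n h1 using c.p_zero _ (Or.inr h1)
  psi_sub x hx y hy h := by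
    induction x using Germ.inductionOn with | _ x
    induction y using Germ.inductionOn with | _ y
    rw [← Germ.coe_sub, Germ.map_coe, Germ.map_coe, Germ.coe_eq]
    filter_upwards [Germ.liftPred_coe.mp hx, Germ.liftPred_coe.mp hy, Germ.coe_lt.mp h]
      with n h1 h2 h3 using c.psi_sub _ h1 _ h2 h3

/-- This is Łoś's theorem for basic conditions: each defines an internal set, negation being the
place where the ultrafilter property enters. -/
theorem IsBasic.exists_internal {P : UPow Γ → Prop} (hP : IsBasic c.germ P) :
    ∃ E : ℕ → Γ → Prop, ∀ y : ℕ → Γ, P y ↔ ∀ᶠ n in (hyperfilter ℕ : Filter ℕ), E n (y n) := by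
  induction hP with
  | mem_Psi => exact ⟨fun _ y => y ∈ c.Psi, fun y => Iff.rfl⟩
  | lt a =>
    induction a using Germ.inductionOn with | _ a
    exact ⟨fun n y => y < a n, fun y => Germ.coe_lt⟩
  | eq a =>
    induction a using Germ.inductionOn with | _ a
    exact ⟨fun n y => y = a n, fun y => Germ.coe_eq⟩
  | psi a b =>
    induction a using Germ.inductionOn with | _ a
    induction b using Germ.inductionOn with | _ b
    refine ⟨fun n y => c.psi (y - a n) = b n, fun y => ?_⟩
    exact Germ.coe_eq (f := fun n => c.psi (y n - a n))
  | not _ ih =>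
    obtain ⟨E, hE⟩ := ih
    exact ⟨fun n y => ¬ E n y, fun y => by
      rw [Ultrafilter.eventually_not, ← hE]⟩
  | and _ _ ih1 ih2 =>
    obtain ⟨E, hE⟩ := ih1
    obtain ⟨E', hE'⟩ := ih2
    exact ⟨fun n y => E n y ∧ E' n y, fun y => by
      rw [Filter.eventually_and, ← hE, ← hE']⟩

theorem hyperfilter_ge (N : ℕ) : ∀ᶠ n in (hyperfilter ℕ : Filter ℕ), N ≤ n :=
  (Nat.hyperfilter_le_atTop) (eventually_ge_atTop N)

/-- Diagonal argument: at index `n` take a point satisfying as many initial conditions as possible,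
up to `n` of them. Each finite set of conditions is satisfiable at almost every index, so each
single condition holds almost everywhere. -/
theorem germ_isSaturated : c.germ.IsSaturated := by
  classical
  intro P hP hfin
  choose E hE using fun i => (hP i).exists_internal
  have hex : ∀ N, ∀ᶠ n in (hyperfilter ℕ : Filter ℕ), ∃ y, ∀ i < N, E i n y := by
    intro N
    obtain ⟨y, hy⟩ := hfin N
    induction y using Germ.inductionOn with | _ y
    have : ∀ᶠ n in (hyperfilter ℕ : Filter ℕ), ∀ i ∈ Set.Iio N, E i n (y n) :=
      (Filter.eventually_all_finite (Set.finite_Iio N)).mpr fun i hi => (hE i y).mp (hy i hi)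
    filter_upwards [this] with n hn using ⟨y n, hn⟩
  let good : ℕ → ℕ → Prop := fun n N => ∃ y, ∀ i < N, E i n y
  let M : ℕ → ℕ := fun n => Nat.findGreatest (good n) n
  have hM : ∀ n, good n (M n) := fun n =>
    Nat.findGreatest_spec (P := good n) (m := 0) (Nat.zero_le _) ⟨0, by simp⟩
  choose y hy using hM
  refine ⟨(y : ℕ → Γ), fun i => (hE i y).mpr ?_⟩
  filter_upwards [hex (i + 1), hyperfilter_ge (i + 1)] with n h1 h2
  exact hy n i (Nat.lt_of_succ_le (Nat.le_findGreatest h2 h1))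

end Germ

end LogCouple

/-! ### Invariance of formulas under isomorphisms of countable closed subspaces. -/

namespace AsymptoticCouple

open LogCouple FirstOrder

variable {Γ : Type*} [AddCommGroup Γ] [LinearOrder Γ] [IsOrderedAddMonoid Γ] [Module ℚ Γ]

/-- Sequences in `Γ_∞` whose germs are both `∞`, or both finite and related by `G`. -/
def SeqRel (G : Submodule ℚ (UPow Γ × UPow Γ)) (u w : ℕ → WithTop Γ) : Prop :=
  ((∀ᶠ n in (hyperfilter ℕ : Filter ℕ), u n = ⊤) ∧ ∀ᶠ n in (hyperfilter ℕ : Filter ℕ), w n = ⊤) ∨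
  ∃ a b : ℕ → Γ, (∀ᶠ n in (hyperfilter ℕ : Filter ℕ), u n = a n) ∧
    (∀ᶠ n in (hyperfilter ℕ : Filter ℕ), w n = b n) ∧ ((a : UPow Γ), (b : UPow Γ)) ∈ G

theorem eventually_top_or_coe (u : ℕ → WithTop Γ) :
    (∀ᶠ n in (hyperfilter ℕ : Filter ℕ), u n = ⊤) ∨
      ∃ a : ℕ → Γ, ∀ᶠ n in (hyperfilter ℕ : Filter ℕ), u n = a n := by
  by_cases h : ∀ᶠ n in (hyperfilter ℕ : Filter ℕ), u n = ⊤
  · exact Or.inl h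
  · rw [← Ultrafilter.eventually_not] at h
    exact Or.inr ⟨fun n => (u n).untopD 0, by
      filter_upwards [h] with n hn using (coe_untopD hn).symm⟩

namespace SeqRel

variable {G : Submodule ℚ (UPow Γ × UPow Γ)} {u w u' w' : ℕ → WithTop Γ}

theorem mono {H : Submodule ℚ (UPow Γ × UPow Γ)} (hGH : G ≤ H) (h : SeqRel G u w) :
    SeqRel H u w := by
  rcases h with h | ⟨a, b, h1, h2, h3⟩
  · exact Or.inl h
  · exact Or.inr ⟨a, b, h1, h2, hGH h3⟩

theorem symm (h : SeqRel G u w) :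
    SeqRel (G.comap (LinearEquiv.prodComm ℚ (UPow Γ) (UPow Γ)).toLinearMap) w u := by
  rcases h with h | ⟨a, b, h1, h2, h3⟩
  · exact Or.inl h.symm
  · exact Or.inr ⟨b, a, h2, h1, PIso.mem_symm.mpr h3⟩

theorem add (h : SeqRel G u w) (h' : SeqRel G u' w') :
    SeqRel G (fun n => u n + u' n) (fun n => w n + w' n) := by
  rcases h with ⟨h1, h2⟩ | ⟨a, b, h1, h2, h3⟩
  · left
    exact ⟨by filter_upwards [h1] with n hn; rw [hn, top_add],
      by filter_upwards [h2] with n hn; rw [hn, top_add]⟩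
  rcases h' with ⟨h1', h2'⟩ | ⟨a', b', h1', h2', h3'⟩
  · left
    exact ⟨by filter_upwards [h1'] with n hn; rw [hn, add_top],
      by filter_upwards [h2'] with n hn; rw [hn, add_top]⟩
  · right
    refine ⟨a + a', b + b', ?_, ?_, G.add_mem h3 h3'⟩
    · filter_upwards [h1, h1'] with n hn hn'; rw [hn, hn']; rfl
    · filter_upwards [h2, h2'] with n hn hn'; rw [hn, hn']; rfl

theorem smul (h : SeqRel G u w) (q : ℚ) :
    SeqRel G (fun n => (u n).map (fun x : Γ => q • x)) (fun n => (w n).map (fun x : Γ => q • x)) := by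
  rcases h with ⟨h1, h2⟩ | ⟨a, b, h1, h2, h3⟩
  · left
    exact ⟨by filter_upwards [h1] with n hn; rw [hn]; rfl,
      by filter_upwards [h2] with n hn; rw [hn]; rfl⟩
  · right
    refine ⟨q • a, q • b, ?_, ?_, G.smul_mem q h3⟩
    · filter_upwards [h1] with n hn; rw [hn]; rfl
    · filter_upwards [h2] with n hn; rw [hn]; rfl

variable {c : LogCouple Γ}

theorem eq_iff (hG : c.germ.PIso G) (h : SeqRel G u w) (h' : SeqRel G u' w') :
    (∀ᶠ n in (hyperfilter ℕ : Filter ℕ), u n = u' n) ↔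
      ∀ᶠ n in (hyperfilter ℕ : Filter ℕ), w n = w' n := by
  have hne : ∀ {f g : ℕ → WithTop Γ} {a : ℕ → Γ},
      (∀ᶠ n in (hyperfilter ℕ : Filter ℕ), f n = ⊤) →
      (∀ᶠ n in (hyperfilter ℕ : Filter ℕ), g n = a n) →
      ¬ (∀ᶠ n in (hyperfilter ℕ : Filter ℕ), f n = g n) := by
    intro f g a h1 h2 h3
    obtain ⟨n, h1, h2, h3⟩ := (h1.and (h2.and h3)).exists
    rw [h1, h2] at h3
    exact absurd h3 (by simp)
  have hne' : ∀ {f g : ℕ → WithTop Γ} {a : ℕ → Γ},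
      (∀ᶠ n in (hyperfilter ℕ : Filter ℕ), f n = ⊤) →
      (∀ᶠ n in (hyperfilter ℕ : Filter ℕ), g n = a n) →
      ¬ (∀ᶠ n in (hyperfilter ℕ : Filter ℕ), g n = f n) := by
    intro f g a h1 h2 h3
    exact hne h1 h2 (h3.mono fun n hn => hn.symm)
  have hcoe : ∀ {f g : ℕ → WithTop Γ} {a b : ℕ → Γ},
      (∀ᶠ n in (hyperfilter ℕ : Filter ℕ), f n = a n) →
      (∀ᶠ n in (hyperfilter ℕ : Filter ℕ), g n = b n) →
      ((∀ᶠ n in (hyperfilter ℕ : Filter ℕ), f n = g n) ↔ (a : UPow Γ) = b) := by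
    intro f g a b h1 h2
    rw [Germ.coe_eq]
    refine Filter.eventually_congr ?_
    filter_upwards [h1, h2] with n h1 h2
    rw [h1, h2, WithTop.coe_inj]
  rcases h with ⟨h1, h2⟩ | ⟨a, b, h1, h2, h3⟩ <;>
  rcases h' with ⟨h1', h2'⟩ | ⟨a', b', h1', h2', h3'⟩
  · exact iff_of_true (by filter_upwards [h1, h1'] with n h h'; rw [h, h'])
      (by filter_upwards [h2, h2'] with n h h'; rw [h, h'])
  · exact iff_of_false (hne h1 h1') (hne h2 h2')
  · exact iff_of_false (hne' h1' h1) (hne' h2' h2)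
  · rw [hcoe h1 h1', hcoe h2 h2', hG.eq_iff h3 h3']

theorem lt_iff (hG : c.germ.PIso G) (h : SeqRel G u w) (h' : SeqRel G u' w') :
    (∀ᶠ n in (hyperfilter ℕ : Filter ℕ), u n < u' n) ↔
      ∀ᶠ n in (hyperfilter ℕ : Filter ℕ), w n < w' n := by
  have hnot : ∀ {f g : ℕ → WithTop Γ},
      (∀ᶠ n in (hyperfilter ℕ : Filter ℕ), f n = ⊤) →
      ¬ (∀ᶠ n in (hyperfilter ℕ : Filter ℕ), f n < g n) := by
    intro f g h1 h3
    obtain ⟨n, h1, h3⟩ := (h1.and h3).exists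
    rw [h1] at h3
    exact not_top_lt h3
  have htop : ∀ {f g : ℕ → WithTop Γ} {a : ℕ → Γ},
      (∀ᶠ n in (hyperfilter ℕ : Filter ℕ), f n = a n) →
      (∀ᶠ n in (hyperfilter ℕ : Filter ℕ), g n = ⊤) →
      (∀ᶠ n in (hyperfilter ℕ : Filter ℕ), f n < g n) := by
    intro f g a h1 h2
    filter_upwards [h1, h2] with n h1 h2
    rw [h1, h2]
    exact WithTop.coe_lt_top _
  have hcoe : ∀ {f g : ℕ → WithTop Γ} {a b : ℕ → Γ},
      (∀ᶠ n in (hyperfilter ℕ : Filter ℕ), f n = a n) →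
      (∀ᶠ n in (hyperfilter ℕ : Filter ℕ), g n = b n) →
      ((∀ᶠ n in (hyperfilter ℕ : Filter ℕ), f n < g n) ↔ (a : UPow Γ) < b) := by
    intro f g a b h1 h2
    rw [Germ.coe_lt]
    refine Filter.eventually_congr ?_
    filter_upwards [h1, h2] with n h1 h2
    rw [h1, h2, WithTop.coe_lt_coe]
  rcases h with ⟨h1, h2⟩ | ⟨a, b, h1, h2, h3⟩
  · exact iff_of_false (hnot h1) (hnot h2)
  rcases h' with ⟨h1', h2'⟩ | ⟨a', b', h1', h2', h3'⟩
  · exact iff_of_true (htop h1 h1') (htop h2 h2')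
  · rw [hcoe h1 h1', hcoe h2 h2', hG.lt_iff h3 h3']

variable [AsymptoticCouple Γ] (hM : IsModelTlog Γ)

theorem succ (hG : hM.logCouple.germ.PIso G) (h : SeqRel G u w) :
    SeqRel G (fun n => AsymptoticCouple.succ (u n)) (fun n => AsymptoticCouple.succ (w n)) := by
  rcases h with ⟨h1, h2⟩ | ⟨a, b, h1, h2, h3⟩
  · left
    exact ⟨by filter_upwards [h1] with n hn; rw [hn]; rfl,
      by filter_upwards [h2] with n hn; rw [hn]; rfl⟩
  · right
    refine ⟨fun n => succFin (a n), fun n => succFin (b n), ?_, ?_, hG.s h3⟩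
    · filter_upwards [h1] with n hn; rw [hn, hM.succ_coe]
    · filter_upwards [h2] with n hn; rw [hn, hM.succ_coe]

theorem psiInf (hG : hM.logCouple.germ.PIso G) (h : SeqRel G u w) :
    SeqRel G (fun n => AsymptoticCouple.psiInf (u n))
      (fun n => AsymptoticCouple.psiInf (w n)) := by
  rcases h with ⟨h1, h2⟩ | ⟨a, b, h1, h2, h3⟩
  · left
    exact ⟨by filter_upwards [h1] with n hn; rw [hn]; rfl,
      by filter_upwards [h2] with n hn; rw [hn]; rfl⟩
  · have hzero : ∀ {f : ℕ → WithTop Γ} {e : ℕ → Γ},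
        (∀ᶠ n in (hyperfilter ℕ : Filter ℕ), f n = e n) → (e : UPow Γ) = 0 →
        ∀ᶠ n in (hyperfilter ℕ : Filter ℕ), AsymptoticCouple.psiInf (f n) = ⊤ := by
      intro f e h h0
      rw [← coe_zero_fun, Germ.coe_eq] at h0
      filter_upwards [h, h0] with n hn hn0
      rw [hn, hn0]
      exact (psi_eq_top_iff (0 : Γ)).mpr rfl
    have hcoe : ∀ {f : ℕ → WithTop Γ} {e : ℕ → Γ},
        (∀ᶠ n in (hyperfilter ℕ : Filter ℕ), f n = e n) → (e : UPow Γ) ≠ 0 →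
        ∀ᶠ n in (hyperfilter ℕ : Filter ℕ),
          AsymptoticCouple.psiInf (f n) = (psiFin (e n) : Γ) := by
      intro f e h h0
      filter_upwards [h, coe_ne_zero_iff.mp h0] with n hn hn0
      rw [hn, coe_psiFin hn0]
      rfl
    -- The case `0` is separate because `ψ 0` is `∞` in the structure but `0` in the `LogCouple`.
    by_cases h0 : (a : UPow Γ) = 0
    · exact Or.inl ⟨hzero h1 h0, hzero h2 ((hG.zero_iff h3).mp h0)⟩
    · exact Or.inr ⟨fun n => psiFin (a n), fun n => psiFin (b n), hcoe h1 h0,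
        hcoe h2 ((hG.zero_iff h3).not.mp h0), hG.psi' h3⟩

theorem germ_mem_Psi_iff (e : ℕ → Γ) :
    ((e : UPow Γ) ∈ hM.logCouple.germ.Psi ∧ (e : UPow Γ) ≠ hM.logCouple.germ.s 0) ↔
      ∀ᶠ n in (hyperfilter ℕ : Filter ℕ), e n ∈ PsiFin Γ ∧ e n ≠ succFin 0 := by
  rw [Filter.eventually_and]
  refine and_congr Iff.rfl ?_
  exact coe_ne_iff (f := e) (g := fun _ => succFin 0)

theorem pred (hG : hM.logCouple.germ.PIso G) (h : SeqRel G u w) :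
    SeqRel G (fun n => AsymptoticCouple.pred (u n)) (fun n => AsymptoticCouple.pred (w n)) := by
  rcases h with ⟨h1, h2⟩ | ⟨a, b, h1, h2, h3⟩
  · have htop : AsymptoticCouple.pred (⊤ : WithTop Γ) = ⊤ := by
      rw [AsymptoticCouple.pred, dif_neg]
      rintro ⟨⟨⟨g, hg, h⟩, -⟩, -⟩
      exact hg ((psi_eq_top_iff g).mp h)
    left
    exact ⟨by filter_upwards [h1] with n hn; rw [hn, htop],
      by filter_upwards [h2] with n hn; rw [hn, htop]⟩
  -- Both sides take the default value `∞` of `p` simultaneously, since `G` preserves `Ψ` and `s 0`.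
  · have hiff : (∀ᶠ n in (hyperfilter ℕ : Filter ℕ), a n ∈ PsiFin Γ ∧ a n ≠ succFin 0) ↔
        ∀ᶠ n in (hyperfilter ℕ : Filter ℕ), b n ∈ PsiFin Γ ∧ b n ≠ succFin 0 := by
      rw [← germ_mem_Psi_iff hM, ← germ_mem_Psi_iff hM, hG.mem_Psi_iff h3, Ne, Ne,
        hG.eq_iff h3 (hG.s (G.zero_mem : ((0 : UPow Γ), (0 : UPow Γ)) ∈ G))]
    by_cases h : ∀ᶠ n in (hyperfilter ℕ : Filter ℕ), a n ∈ PsiFin Γ ∧ a n ≠ succFin 0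
    · right
      refine ⟨fun n => predFin (a n), fun n => predFin (b n), ?_, ?_, hG.p_mem h3⟩
      · filter_upwards [h1, h] with n hn hn'; rw [hn, (hM.pred_coe hn').1]
      · filter_upwards [h2, hiff.mp h] with n hn hn'; rw [hn, (hM.pred_coe hn').1]
    · left
      have h' := hiff.not.mp h
      rw [← Ultrafilter.eventually_not] at h h'
      constructor
      · filter_upwards [h1, h] with n hn hn'; rw [hn, hM.pred_eq_top hn']
      · filter_upwards [h2, h'] with n hn hn'; rw [hn, hM.pred_eq_top hn']

theorem const_zero : SeqRel G (fun _ => ((0 : Γ) : WithTop Γ)) (fun _ => ((0 : Γ) : WithTop Γ)) :=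
  Or.inr ⟨fun _ => 0, fun _ => 0, Eventually.of_forall fun _ => rfl,
    Eventually.of_forall fun _ => rfl, G.zero_mem⟩

theorem const_top : SeqRel G (fun _ => (⊤ : WithTop Γ)) (fun _ => ⊤) :=
  Or.inl ⟨Eventually.of_forall fun _ => rfl, Eventually.of_forall fun _ => rfl⟩

theorem funMap (hG : hM.logCouple.germ.PIso G) {n : ℕ} (f : LFunctions n)
    (v v' : Fin n → ℕ → WithTop Γ) (h : ∀ i, SeqRel G (v i) (v' i)) :
    SeqRel G (fun k => Language.Structure.funMap (L := L) (show L.Functions n from f)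
        (fun i => v i k))
      (fun k => Language.Structure.funMap (L := L) (show L.Functions n from f)
        (fun i => v' i k)) := by
  cases f with
  | zero => exact const_zero
  | infty => exact const_top
  | add => exact (h 0).add (h 1)
  | neg =>
    have h1 := (h 0).smul (-1)
    simp only [neg_smul, one_smul] at h1
    exact h1
  | psi => exact (h 0).psiInf hM hG
  | succ => exact (h 0).succ hM hG
  | pred => exact (h 0).pred hM hG
  | delta m => exact (h 0).smul _

theorem term (hG : hM.logCouple.germ.PIso G) {β : Type*} (t : L.Term β)
    {v v' : β → ℕ → WithTop Γ} (h : ∀ i, SeqRel G (v i) (v' i)) :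
    SeqRel G (fun k => t.realize (fun i => v i k)) (fun k => t.realize (fun i => v' i k)) := by
  induction t with
  | var i => exact h i
  | func f ts ih =>
    exact funMap hM hG f (fun i k => (ts i).realize (fun j => v j k))
      (fun i k => (ts i).realize (fun j => v' j k)) ih

theorem exists_left (hG : hM.logCouple.germ.PIso G) [Countable G] (y : ℕ → WithTop Γ) :
    ∃ H, hM.logCouple.germ.PIso H ∧ Countable H ∧ G ≤ H ∧ ∃ z, SeqRel H y z := by
  rcases eventually_top_or_coe y with h | ⟨a, ha⟩
  · exact ⟨G, hG, inferInstance, le_rfl, fun _ => ⊤, Or.inl ⟨h, Eventually.of_forall fun _ => rfl⟩⟩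
  have hdomc : ((G.map (LinearMap.fst ℚ (UPow Γ) (UPow Γ)) : Submodule ℚ (UPow Γ)) :
      Set (UPow Γ)).Countable := by
    rw [Submodule.map_coe]
    exact (Set.to_countable (G : Set (UPow Γ × UPow Γ))).image _
  obtain ⟨D, hD, hDc, hDS⟩ := exists_isClosed hM.logCouple.germ _
    (hdomc.union (Set.countable_singleton (a : UPow Γ)))
  obtain ⟨H, hH, hGH, hdom, -⟩ := hG.exists_extension (germ_isSaturated _) (C := ⊥) hD hDc
    (fun x hx => hDS (Or.inl hx)) (Set.countable_singleton 0)
  have haD : (a : UPow Γ) ∈ H.map (LinearMap.fst ℚ (UPow Γ) (UPow Γ)) := by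
    rw [hdom]
    exact hDS (Or.inr rfl)
  obtain ⟨b, hb⟩ := PIso.mem_dom.mp haD
  induction b using Germ.inductionOn with | _ b
  exact ⟨H, hH, hH.countable hDc hdom.le, hGH, fun n => b n,
    Or.inr ⟨a, b, ha, Eventually.of_forall fun _ => rfl, hb⟩⟩

end SeqRel

theorem countable_symm {G : Submodule ℚ (UPow Γ × UPow Γ)} [Countable G] :
    Countable (G.comap (LinearEquiv.prodComm ℚ (UPow Γ) (UPow Γ)).toLinearMap) := by
  refine Function.Injective.countable
    (f := fun g : (G.comap (LinearEquiv.prodComm ℚ (UPow Γ) (UPow Γ)).toLinearMap) =>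
      (⟨(g.1.2, g.1.1), PIso.mem_symm.mp g.2⟩ : G)) ?_
  rintro ⟨⟨a, b⟩, h⟩ ⟨⟨a', b'⟩, h'⟩ h1
  have h2 : (b, a) = (b', a') := congrArg Subtype.val h1
  obtain ⟨rfl, rfl⟩ := Prod.mk.inj h2
  rfl

variable [AsymptoticCouple Γ] (hM : IsModelTlog Γ)

/-- Truth of formulas in the ultrapower is invariant under isomorphisms of countable closed
subspaces. -/
theorem realize_iff_of_seqRel {α : Type*} {n : ℕ} (φ : L.BoundedFormula α n)
    (G : Submodule ℚ (UPow Γ × UPow Γ)) (hG : hM.logCouple.germ.PIso G) (hGc : Countable G)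
    (v v' : α → ℕ → WithTop Γ) (xs xs' : Fin n → ℕ → WithTop Γ)
    (h : ∀ i, SeqRel G (v i) (v' i)) (hx : ∀ i, SeqRel G (xs i) (xs' i)) :
    (∀ᶠ k in (hyperfilter ℕ : Filter ℕ), φ.Realize (fun i => v i k) (fun i => xs i k)) ↔
      ∀ᶠ k in (hyperfilter ℕ : Filter ℕ), φ.Realize (fun i => v' i k) (fun i => xs' i k) := by
  have helim : ∀ {n : ℕ} (v : α → ℕ → WithTop Γ) (xs : Fin n → ℕ → WithTop Γ) (k : ℕ),
      (Sum.elim (fun i => v i k) (fun i => xs i k) : α ⊕ Fin n → WithTop Γ) =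
        fun i => Sum.elim v xs i k := by
    intro n v xs k
    funext i
    cases i <;> rfl
  have hsum : ∀ {n : ℕ} {G : Submodule ℚ (UPow Γ × UPow Γ)} {v v' : α → ℕ → WithTop Γ}
      {xs xs' : Fin n → ℕ → WithTop Γ}, (∀ i, SeqRel G (v i) (v' i)) →
      (∀ i, SeqRel G (xs i) (xs' i)) → ∀ i, SeqRel G (Sum.elim v xs i) (Sum.elim v' xs' i) := by
    intro n G v v' xs xs' h h' i
    cases i
    · exact h _
    · exact h' _
  induction φ generalizing G v v' with
  | falsum =>
    refine iff_of_false (fun hf => ?_) (fun hf => ?_) <;>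
    exact hf.exists.elim fun _ h => h
  | equal t₁ t₂ =>
    simp only [Language.BoundedFormula.Realize, helim]
    exact SeqRel.eq_iff hG (SeqRel.term hM hG t₁ (hsum h hx)) (SeqRel.term hM hG t₂ (hsum h hx))
  | @rel n l R ts =>
    simp only [Language.BoundedFormula.Realize, helim]
    have hts := fun i => SeqRel.term hM hG (ts i) (hsum h hx)
    change LRelations l at R
    cases R with
    | lt => exact SeqRel.lt_iff hG (hts 0) (hts 1)
  | imp f₁ f₂ ih₁ ih₂ =>
    simp only [Language.BoundedFormula.realize_imp]
    rw [Ultrafilter.eventually_imp, Ultrafilter.eventually_imp]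
    exact imp_congr (ih₁ G hG hGc v v' xs xs' h hx) (ih₂ G hG hGc v v' xs xs' h hx)
  | @all n f ih =>
    simp only [Language.BoundedFormula.realize_all]
    have hsnoc : ∀ (xs : Fin n → ℕ → WithTop Γ) (z : ℕ → WithTop Γ) (k : ℕ),
        (Fin.snoc (fun i => xs i k) (z k) : Fin (n + 1) → WithTop Γ) =
          fun i => (Fin.snoc xs z : Fin (n + 1) → ℕ → WithTop Γ) i k := by
      intro xs z k
      funext i
      refine Fin.lastCases ?_ (fun j => ?_) i
      · simp
      · simp
    have key : ∀ (G : Submodule ℚ (UPow Γ × UPow Γ)), hM.logCouple.germ.PIso G → Countable G →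
        ∀ (v v' : α → ℕ → WithTop Γ) (xs xs' : Fin n → ℕ → WithTop Γ),
        (∀ i, SeqRel G (v i) (v' i)) → (∀ i, SeqRel G (xs i) (xs' i)) →
        (∀ᶠ k in (hyperfilter ℕ : Filter ℕ), ∀ a,
          f.Realize (fun i => v' i k) (Fin.snoc (fun i => xs' i k) a)) →
        ∀ᶠ k in (hyperfilter ℕ : Filter ℕ), ∀ a,
          f.Realize (fun i => v i k) (Fin.snoc (fun i => xs i k) a) := by
      intro G hG hGc v v' xs xs' h hx hall
      by_contra hcon
      rw [← Ultrafilter.eventually_not] at hcon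
      -- The sequence `y` picks a counterexample at every index that has one. Its germ gets a
      -- partner `z` by extending the isomorphism, and the induction hypothesis turns `z` into a
      -- counterexample on the other side.
      have hch : ∀ k, ∃ y : WithTop Γ,
          (¬ ∀ a, f.Realize (fun i => v i k) (Fin.snoc (fun i => xs i k) a)) →
          ¬ f.Realize (fun i => v i k) (Fin.snoc (fun i => xs i k) y) := by
        intro k
        by_cases hk : ∀ a, f.Realize (fun i => v i k) (Fin.snoc (fun i => xs i k) a)
        · exact ⟨⊤, fun h => absurd hk h⟩
        · obtain ⟨y, hy⟩ := not_forall.mp hk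
          exact ⟨y, fun _ => hy⟩
      choose y hy using hch
      obtain ⟨H, hH, hHc, hGH, z, hyz⟩ := SeqRel.exists_left hM hG y
      have hIH := ih H hH hHc v v' (Fin.snoc xs y) (Fin.snoc xs' z) (fun i => (h i).mono hGH)
        (fun i => by
          refine Fin.lastCases ?_ (fun j => ?_) i
          · simpa using hyz
          · simpa using (hx j).mono hGH)
      have h1 : ∀ᶠ k in (hyperfilter ℕ : Filter ℕ), f.Realize (fun i => v' i k)
          (fun i => (Fin.snoc xs' z : Fin (n + 1) → ℕ → WithTop Γ) i k) := by
        filter_upwards [hall] with k hk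
        rw [← hsnoc]
        exact hk _
      obtain ⟨k, hk1, hk2⟩ := ((hIH.mpr h1).and hcon).exists
      rw [← hsnoc] at hk1
      exact hy k hk2 hk1
    exact ⟨key _ hG.symm countable_symm v' v xs' xs (fun i => (h i).symm) (fun i => (hx i).symm),
      key G hG hGc v v' xs xs' h hx⟩

end AsymptoticCouple

/-! ### Definable functions on `Ψ`: candidates, conjugacy over the parameters, compactness. -/

namespace AsymptoticCouple

open LogCouple FirstOrder

variable {Γ : Type*} [AddCommGroup Γ] [LinearOrder Γ] [IsOrderedAddMonoid Γ] [Module ℚ Γ]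

variable (Γ) in
/-- The diagonal embedding of `Γ` into its ultrapower. -/
noncomputable def constHom : Γ →ₗ[ℚ] UPow Γ where
  toFun a := ((fun _ => a : ℕ → Γ) : UPow Γ)
  map_add' _ _ := rfl
  map_smul' _ _ := rfl

theorem isClosed_map_const {c : LogCouple Γ} {A : Submodule ℚ Γ} (hA : c.IsClosed A) :
    c.germ.IsClosed (A.map (constHom Γ)) where
  psi := by
    rintro _ ⟨a, ha, rfl⟩
    exact ⟨c.psi a, hA.psi ha, rfl⟩
  s := by
    rintro _ ⟨a, ha, rfl⟩
    exact ⟨c.s a, hA.s ha, rfl⟩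
  p := by
    rintro _ ⟨a, ha, rfl⟩
    exact ⟨c.p a, hA.p ha, rfl⟩

theorem countable_map_const {A : Submodule ℚ Γ} (hA : (A : Set Γ).Countable) :
    ((A.map (constHom Γ) : Submodule ℚ (UPow Γ)) : Set (UPow Γ)).Countable := by
  rw [Submodule.map_coe]
  exact hA.image _

theorem diag_le {A : Submodule ℚ (UPow Γ)} {B : Submodule ℚ (UPow Γ)} (h : A ≤ B) :
    diag A ≤ diag B := by
  rintro ⟨a, b⟩ hab
  obtain ⟨h1, h2⟩ := mem_diag.mp hab
  exact mem_diag.mpr ⟨h h1, h2⟩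

theorem countable_diag {A : Submodule ℚ (UPow Γ)} (hA : (A : Set (UPow Γ)).Countable) :
    Countable (diag A) := by
  have : ((diag A : Submodule ℚ (UPow Γ × UPow Γ)) : Set (UPow Γ × UPow Γ)).Countable := by
    rw [diag, Submodule.map_coe]
    exact hA.image _
  exact this.to_subtype

variable [AsymptoticCouple Γ]

/-- The function `x ↦ a + ∑ q_k s^k(x)`. -/
noncomputable def sFun (a : Γ) (q : ℤ →₀ ℚ) (x : WithTop Γ) : WithTop Γ :=
  (∑ k ∈ q.support, (succPow k x).map (fun γ : Γ => q k • γ)) + (a : WithTop Γ)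

theorem isSFunction_sFun (a : Γ) (q : ℤ →₀ ℚ) :
    IsSFunction (fun x : Psi Γ => sFun a q (x : WithTop Γ)) := by
  by_cases hq : q = 0
  · left
    exact ⟨a, fun x => by simp [sFun, hq]⟩
  · right
    refine ⟨q.support.card, q.support.orderEmbOfFin rfl,
      fun j => q (q.support.orderEmbOfFin rfl j), -a,
      Finset.card_pos.mpr (Finsupp.support_nonempty_iff.mpr hq),
      (q.support.orderEmbOfFin rfl).strictMono,
      fun j => Finsupp.mem_support_iff.mp (Finset.orderEmbOfFin_mem _ rfl j), fun x => ?_⟩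
    simp only [neg_neg, sFun]
    congr 1
    conv_lhs => rw [← Finset.map_orderEmbOfFin_univ q.support rfl, Finset.sum_map]
    rfl

namespace SeqRel

variable {G : Submodule ℚ (UPow Γ × UPow Γ)} {u w : ℕ → WithTop Γ} (hM : IsModelTlog Γ)

theorem succPow (hG : hM.logCouple.germ.PIso G) (h : SeqRel G u w) (k : ℤ) :
    SeqRel G (fun n => AsymptoticCouple.succPow k (u n))
      (fun n => AsymptoticCouple.succPow k (w n)) := by
  have hs : ∀ m : ℕ, SeqRel G (fun n => AsymptoticCouple.succ^[m] (u n))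
      (fun n => AsymptoticCouple.succ^[m] (w n)) := by
    intro m
    induction m with
    | zero => exact h
    | succ m ih =>
      simp only [Function.iterate_succ_apply']
      exact ih.succ hM hG
  have hp : ∀ m : ℕ, SeqRel G (fun n => AsymptoticCouple.pred^[m] (u n))
      (fun n => AsymptoticCouple.pred^[m] (w n)) := by
    intro m
    induction m with
    | zero => exact h
    | succ m ih =>
      simp only [Function.iterate_succ_apply']
      exact ih.pred hM hG
  rcases k with m | m
  · exact hs m
  · exact hp (m + 1)

theorem sum {ι : Type*} (t : Finset ι) (f g : ι → ℕ → WithTop Γ)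
    (h : ∀ i ∈ t, SeqRel G (f i) (g i)) :
    SeqRel G (fun n => ∑ i ∈ t, f i n) (fun n => ∑ i ∈ t, g i n) := by
  classical
  induction t using Finset.induction_on with
  | empty => exact const_zero
  | insert i t hi ih =>
    simp only [Finset.sum_insert hi]
    exact (h i (Finset.mem_insert_self _ _)).add
      (ih fun j hj => h j (Finset.mem_insert_of_mem hj))

theorem const {A : Submodule ℚ Γ} (hA : diag (A.map (constHom Γ)) ≤ G) {a : Γ} (ha : a ∈ A) :
    SeqRel G (fun _ => (a : WithTop Γ)) (fun _ => (a : WithTop Γ)) :=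
  Or.inr ⟨fun _ => a, fun _ => a, Eventually.of_forall fun _ => rfl,
    Eventually.of_forall fun _ => rfl, hA (mem_diag.mpr ⟨⟨a, ha, rfl⟩, rfl⟩)⟩

theorem sFun (hG : hM.logCouple.germ.PIso G) {A : Submodule ℚ Γ}
    (hA : diag (A.map (constHom Γ)) ≤ G) {a : Γ} (ha : a ∈ A) (q : ℤ →₀ ℚ) (h : SeqRel G u w) :
    SeqRel G (fun n => AsymptoticCouple.sFun a q (u n))
      (fun n => AsymptoticCouple.sFun a q (w n)) :=
  (sum q.support _ _ fun k _ => (h.succPow hM hG k).smul (q k)).add (const hA ha)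

end SeqRel

/-- The members of the chain of a germ `u` outside a closed subspace are the germs of `s^k(u)`. -/
theorem chain_eq_coe (hM : IsModelTlog Γ) {A : Submodule ℚ (UPow Γ)} {u : ℕ → Γ}
    (hx : hM.logCouple.germ.IsPsiChain A (chain hM.logCouple.germ (u : UPow Γ)))
    (hA : hM.logCouple.germ.IsClosed A) (k : ℤ) :
    ∃ w : ℕ → Γ, chain hM.logCouple.germ (u : UPow Γ) k = w ∧
      ∀ᶠ n in (hyperfilter ℕ : Filter ℕ), succPow k (u n : WithTop Γ) = w n := by
  have hs : ∀ m : ℕ, ∃ w : ℕ → Γ, hM.logCouple.germ.s^[m] (u : UPow Γ) = w ∧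
      ∀ᶠ n in (hyperfilter ℕ : Filter ℕ), succ^[m] (u n : WithTop Γ) = w n := by
    intro m
    induction m with
    | zero => exact ⟨u, rfl, Eventually.of_forall fun n => rfl⟩
    | succ m ih =>
      obtain ⟨w, h1, h2⟩ := ih
      refine ⟨fun n => succFin (w n), ?_, ?_⟩
      · rw [Function.iterate_succ_apply', h1]
        rfl
      · filter_upwards [h2] with n hn
        rw [Function.iterate_succ_apply', hn, hM.succ_coe]
  have hp : ∀ m : ℕ, ∃ w : ℕ → Γ, hM.logCouple.germ.p^[m] (u : UPow Γ) = w ∧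
      ∀ᶠ n in (hyperfilter ℕ : Filter ℕ), pred^[m] (u n : WithTop Γ) = w n := by
    intro m
    induction m with
    | zero => exact ⟨u, rfl, Eventually.of_forall fun n => rfl⟩
    | succ m ih =>
      obtain ⟨w, h1, h2⟩ := ih
      have h3 : (w : UPow Γ) = chain hM.logCouple.germ (u : UPow Γ) (-m) := by
        rw [← h1]
        have := hx.iterate_p m 0
        rw [chain_zero] at this
        rw [this, zero_sub]
      -- The chain avoids `s 0 ∈ A`, so no default value of `p` is ever used and `p` on germs agrees
      -- with `p` on `Γ_∞`.
      have h4 : (w : UPow Γ) ∈ hM.logCouple.germ.Psi ∧ (w : UPow Γ) ≠ hM.logCouple.germ.s 0 := by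
        rw [h3]
        exact ⟨hx.mem _, fun h => hx.notMem _ (h ▸ hA.s A.zero_mem)⟩
      refine ⟨fun n => predFin (w n), ?_, ?_⟩
      · rw [Function.iterate_succ_apply', h1]
        rfl
      · filter_upwards [h2, (SeqRel.germ_mem_Psi_iff hM w).mp h4] with n hn hn'
        rw [Function.iterate_succ_apply', hn, (hM.pred_coe hn').1]
  rcases k with m | m
  · exact hs m
  · exact hp (m + 1)

/-- If `a + ∑ q_k s^k(u)` is formed in the ultrapower with all `s^k(u)` finite, it is the germ of
`sFun a q`. -/
theorem eventually_sFun_eq (hM : IsModelTlog Γ) {A : Submodule ℚ (UPow Γ)} {u : ℕ → Γ}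
    (hx : hM.logCouple.germ.IsPsiChain A (chain hM.logCouple.germ (u : UPow Γ)))
    (hA : hM.logCouple.germ.IsClosed A) {a : Γ} {q : ℤ →₀ ℚ} {b : ℕ → Γ}
    (hb : (b : UPow Γ) = constHom Γ a + IsPsiChain.comb (chain hM.logCouple.germ (u : UPow Γ)) q) :
    ∀ᶠ n in (hyperfilter ℕ : Filter ℕ), (b n : WithTop Γ) = sFun a q (u n : WithTop Γ) := by
  choose w hw1 hw2 using chain_eq_coe hM hx hA
  have hsum : IsPsiChain.comb (chain hM.logCouple.germ (u : UPow Γ)) q =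
      ((fun n => ∑ k ∈ q.support, q k • w k n : ℕ → Γ) : UPow Γ) := by
    rw [IsPsiChain.comb, Finsupp.linearCombination_apply, Finsupp.sum]
    simp only [hw1]
    have : ∀ t : Finset ℤ, ∑ k ∈ t, q k • (w k : UPow Γ) =
        ((fun n => ∑ k ∈ t, q k • w k n : ℕ → Γ) : UPow Γ) := by
      intro t
      induction t using Finset.induction_on with
      | empty => rfl
      | insert i t hi ih =>
        simp only [Finset.sum_insert hi]
        rw [ih]
        rfl
    exact this _
  rw [hsum] at hb
  have hb' := Germ.coe_eq.mp (hb.trans (Germ.coe_add _ _).symm)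
  have hall : ∀ᶠ n in (hyperfilter ℕ : Filter ℕ), ∀ k ∈ (q.support : Set ℤ),
      succPow k (u n : WithTop Γ) = w k n :=
    (Filter.eventually_all_finite q.support.finite_toSet).mpr fun k _ => hw2 k
  filter_upwards [hb', hall] with n h1 h2
  have h3 : b n = a + ∑ k ∈ q.support, q k • w k n := h1
  have h4 : ∑ k ∈ q.support, (succPow k (u n : WithTop Γ)).map (fun γ : Γ => q k • γ) =
      ((∑ k ∈ q.support, q k • w k n : Γ) : WithTop Γ) := by
    rw [WithTop.coe_sum]
    refine Finset.sum_congr rfl fun k hk => ?_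
    rw [h2 k hk]
    rfl
  rw [sFun, h4, h3, add_comm]
  rfl

/-- `F` as a function on `Ψ ⊆ Γ`. -/
def onFin (F : Psi Γ → WithTop Γ) (x : PsiFin Γ) : WithTop Γ := F ⟨(x.1 : WithTop Γ), x.2⟩

/-- `F` is defined by a formula with parameters in `A`. -/
def TransfersOver (hM : IsModelTlog Γ) (F : Psi Γ → WithTop Γ) (A : Submodule ℚ Γ) : Prop :=
  ∀ G : Submodule ℚ (UPow Γ × UPow Γ), hM.logCouple.germ.PIso G → Countable G →
    diag (A.map (constHom Γ)) ≤ G → ∀ (u u' : ℕ → PsiFin Γ) (f f' : ℕ → WithTop Γ),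
    (((fun n => (u n).1 : ℕ → Γ) : UPow Γ), ((fun n => (u' n).1 : ℕ → Γ) : UPow Γ)) ∈ G →
    SeqRel G f f' → (∀ᶠ n in (hyperfilter ℕ : Filter ℕ), onFin F (u n) = f n) →
    ∀ᶠ n in (hyperfilter ℕ : Filter ℕ), onFin F (u' n) = f' n

theorem exists_transfersOver (hM : IsModelTlog Γ) {F : Psi Γ → WithTop Γ} (hF : IsDefinable F) :
    ∃ A : Submodule ℚ Γ, hM.logCouple.IsClosed A ∧ (A : Set Γ).Countable ∧
      TransfersOver hM F A := by
  obtain ⟨P, -, hP⟩ := Set.definable_iff_finitely_definable.mp hF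
  obtain ⟨φ, hφ⟩ := Set.definable_iff_exists_formula_sum.mp hP
  obtain ⟨A, hA, hAc, hPA⟩ := exists_isClosed hM.logCouple
    -- A parameter `∞` may be dropped: `SeqRel` always relates it to itself.
    {a : Γ | (a : WithTop Γ) ∈ P}
    ((P.finite_toSet.preimage (WithTop.coe_injective.injOn)).countable)
  refine ⟨A, hA, hAc, ?_⟩
  intro G hG hGc hAG u u' f f' hu hf hFu
  let par : (ℕ → PsiFin Γ) → (ℕ → WithTop Γ) → (P : Set (WithTop Γ)) ⊕ Fin 2 → ℕ → WithTop Γ :=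
    fun u f => Sum.elim (fun a _ => a.1) ![fun n => ((u n).1 : WithTop Γ), f]
  have hpar : ∀ (u : ℕ → PsiFin Γ) (f : ℕ → WithTop Γ) (n : ℕ),
      φ.Realize (fun i => par u f i n) ↔ onFin F (u n) = f n := by
    intro u f n
    have h1 : (fun i => par u f i n) =
        Sum.elim (fun a : (P : Set (WithTop Γ)) => a.1) ![((u n).1 : WithTop Γ), f n] := by
      funext i
      rcases i with a | i
      · rfl
      · fin_cases i <;> rfl
    have h2 := Set.ext_iff.mp hφ ![((u n).1 : WithTop Γ), f n]
    rw [Set.mem_ofPred_eq, Set.mem_ofPred_eq] at h2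
    rw [h1]
    refine h2.symm.trans ?_
    constructor
    · rintro ⟨x, hx, hy⟩
      have hx' : ((u n).1 : WithTop Γ) = x := hx
      have hy' : f n = F x := hy
      rw [hy', onFin]
      congr 1
      exact Subtype.ext hx'
    · intro h
      exact ⟨⟨((u n).1 : WithTop Γ), (u n).2⟩, rfl, h.symm⟩
  have hrel : ∀ i, SeqRel G (par u f i) (par u' f' i) := by
    rintro (⟨a, ha⟩ | i)
    · induction a using WithTop.recTopCoe with
      | top => exact SeqRel.const_top
      | coe a => exact SeqRel.const hAG (hPA ha)
    · fin_cases i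
      · exact Or.inr ⟨_, _, Eventually.of_forall fun n => rfl, Eventually.of_forall fun n => rfl, hu⟩
      · exact hf
  have hmain := realize_iff_of_seqRel hM φ G hG hGc (par u f) (par u' f') (fun i => i.elim0)
    (fun i => i.elim0) hrel (fun i => i.elim0)
  have hreal : ∀ (u : ℕ → PsiFin Γ) (f : ℕ → WithTop Γ) (n : ℕ),
      Language.BoundedFormula.Realize φ (fun i => par u f i n)
        (fun i : Fin 0 => (i.elim0 : ℕ → WithTop Γ) n) ↔ onFin F (u n) = f n := by
    intro u f n
    rw [← hpar u f n, Language.Formula.Realize]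
    exact iff_of_eq (congrArg _ (Subsingleton.elim _ _))
  have h1 : ∀ᶠ n in (hyperfilter ℕ : Filter ℕ), Language.BoundedFormula.Realize φ
      (fun i => par u f i n) (fun i : Fin 0 => (i.elim0 : ℕ → WithTop Γ) n) :=
    hFu.mono fun n hn => (hreal u f n).mpr hn
  exact (hmain.mp h1).mono fun n hn => (hreal u' f' n).mp hn

/-- The value of `F` at `u` lies in every countable closed subspace containing the parameters
and `u`. -/
theorem TransfersOver.mem {hM : IsModelTlog Γ} {F : Psi Γ → WithTop Γ} {A : Submodule ℚ Γ}
    (hF : TransfersOver hM F A) {B : Submodule ℚ (UPow Γ)} (hB : hM.logCouple.germ.IsClosed B)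
    (hBc : (B : Set (UPow Γ)).Countable) (hAB : A.map (constHom Γ) ≤ B) {u : ℕ → PsiFin Γ}
    (hu : ((fun n => (u n).1 : ℕ → Γ) : UPow Γ) ∈ B) {b : ℕ → Γ}
    (hb : ∀ᶠ n in (hyperfilter ℕ : Filter ℕ), onFin F (u n) = b n) : (b : UPow Γ) ∈ B := by
  obtain ⟨D, hD, hDc, hDS⟩ := exists_isClosed hM.logCouple.germ _
    (hBc.union (Set.countable_singleton (b : UPow Γ)))
  -- The identity of `B` is extended with new values kept off `D ∋ b`. Its image `b'` of `b` is also
  -- a value of `F` at `u`, so `b' = b ∈ D`; this is not a new value, whence `b ∈ B`.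
  obtain ⟨H, hH, hGH, hdom, hfree⟩ := hB.pIso_diag.exists_extension (germ_isSaturated _)
    (C := D) hD hDc
    (by
      intro x hx
      obtain ⟨y, hy⟩ := PIso.mem_dom.mp hx
      exact hDS (Or.inl (mem_diag.mp hy).1)) hDc
  have hbD : (b : UPow Γ) ∈ D := hDS (Or.inr rfl)
  obtain ⟨b', hb'⟩ := PIso.mem_dom.mp (hdom ▸ hbD)
  induction b' using Germ.inductionOn with | _ b'
  have h1 := hF H hH (hH.countable hDc hdom.le) ((diag_le hAB).trans hGH) u u
    (fun n => b n) (fun n => b' n) (hGH (mem_diag.mpr ⟨hu, rfl⟩))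
    (Or.inr ⟨b, b', Eventually.of_forall fun _ => rfl, Eventually.of_forall fun _ => rfl, hb'⟩) hb
  have h2 : (b : UPow Γ) = b' := Germ.coe_eq.mpr (by
    filter_upwards [hb, h1] with n h3 h4
    rw [h3] at h4
    exact_mod_cast h4)
  exact (mem_diag.mp (hfree _ _ hb' (h2 ▸ hbD))).1

theorem countable_addChain {c : LogCouple (UPow Γ)} {A : Submodule ℚ (UPow Γ)}
    (hAc : (A : Set (UPow Γ)).Countable) {x y : UPow Γ}
    (hG : c.PIso (addChain (diag A) (chain c x) (chain c y))) :
    Countable (addChain (diag A) (chain c x) (chain c y)) := by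
  obtain ⟨D, hD, hDc, hDS⟩ := exists_isClosed c _ (hAc.union (Set.countable_singleton x))
  refine hG.countable hDc fun z hz => ?_
  obtain ⟨w, hw⟩ := PIso.mem_dom.mp hz
  obtain ⟨a, b, q, hab, rfl, -⟩ := mem_addChain.mp hw
  exact D.add_mem (hDS (Or.inl (mem_diag.mp hab).1))
    (comb_mem (hD.chain_mem (hDS (Or.inr rfl))) q)

theorem dom_diag (A : Submodule ℚ (UPow Γ)) :
    (diag A).map (LinearMap.fst ℚ (UPow Γ) (UPow Γ)) = A := by
  ext x
  rw [PIso.mem_dom]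
  exact ⟨fun ⟨y, hy⟩ => (mem_diag.mp hy).1, fun h => ⟨x, mem_diag.mpr ⟨h, rfl⟩⟩⟩

theorem ran_diag (A : Submodule ℚ (UPow Γ)) :
    (diag A).map (LinearMap.snd ℚ (UPow Γ) (UPow Γ)) = A := by
  ext x
  rw [PIso.mem_ran]
  exact ⟨fun ⟨y, hy⟩ => (mem_diag.mp hy).2 ▸ (mem_diag.mp hy).1,
    fun h => ⟨x, mem_diag.mpr ⟨h, rfl⟩⟩⟩

/-- Two elements of `Ψ` outside `A` with the same cut in `A ∩ Ψ` are conjugate over `A`. -/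
theorem pIso_addChain_diag {c : LogCouple (UPow Γ)} {A : Submodule ℚ (UPow Γ)}
    (hA : c.IsClosed A) {x y : UPow Γ} (hx : x ∈ c.Psi) (hxA : x ∉ A) (hy : y ∈ c.Psi)
    (hyA : y ∉ A) (hcut : ∀ z ∈ A, z ∈ c.Psi → (x < z ↔ y < z)) :
    c.PIso (addChain (diag A) (chain c x) (chain c y)) := by
  refine hA.pIso_diag.addChain ?_ ?_ ?_
  · rw [dom_diag]; exact hA.isPsiChain hx hxA
  · rw [ran_diag]; exact hA.isPsiChain hy hyA
  · intro a b hab ha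
    obtain ⟨h1, rfl⟩ := mem_diag.mp hab
    exact hcut a h1 ha

/-- At each point of the ultrapower, `F` agrees with one of the functions `∞`, `sFun a q`. -/
theorem TransfersOver.eventually_eq {hM : IsModelTlog Γ} {F : Psi Γ → WithTop Γ}
    {A : Submodule ℚ Γ} (hA : hM.logCouple.IsClosed A) (hAc : (A : Set Γ).Countable)
    (hF : TransfersOver hM F A) (u : ℕ → PsiFin Γ) :
    (∀ᶠ n in (hyperfilter ℕ : Filter ℕ), onFin F (u n) = ⊤) ∨
      ∃ a ∈ A, ∃ q, ∀ᶠ n in (hyperfilter ℕ : Filter ℕ),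
        onFin F (u n) = sFun a q ((u n).1 : WithTop Γ) := by
  rcases eventually_top_or_coe (fun n => onFin F (u n)) with h | ⟨b, hb⟩
  · exact Or.inl h
  right
  have hA' := isClosed_map_const hA
  have hAc' := countable_map_const hAc
  have huP : ((fun n => (u n).1 : ℕ → Γ) : UPow Γ) ∈ hM.logCouple.germ.Psi :=
    Eventually.of_forall fun n => (u n).2
  by_cases hu : ((fun n => (u n).1 : ℕ → Γ) : UPow Γ) ∈ A.map (constHom Γ)
  · obtain ⟨a, ha, hab⟩ := hF.mem hA' hAc' le_rfl hu hb
    refine ⟨a, ha, 0, ?_⟩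
    filter_upwards [hb, Germ.coe_eq.mp hab] with n h1 h2
    rw [h1, ← h2]
    simp [sFun]
  -- The chain of `u` is matched with itself merely to see that the span of `A` and this chain is
  -- closed: it is the domain of an isomorphism.
  · have hG := pIso_addChain_diag hA' huP hu huP hu (fun _ _ _ => Iff.rfl)
    have hGc := countable_addChain hAc' hG
    set G := addChain (diag (A.map (constHom Γ))) (chain hM.logCouple.germ _)
      (chain hM.logCouple.germ _) with hGdef
    have hdomc : ((G.map (LinearMap.fst ℚ (UPow Γ) (UPow Γ)) : Submodule ℚ (UPow Γ)) :
        Set (UPow Γ)).Countable := by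
      rw [Submodule.map_coe]
      exact (Set.to_countable (G : Set (UPow Γ × UPow Γ))).image _
    have hmem := hF.mem hG.isClosed_dom hdomc
      (fun x hx => PIso.mem_dom.mpr ⟨x, le_addChain _ _ _ (mem_diag.mpr ⟨hx, rfl⟩)⟩)
      (PIso.mem_dom.mpr ⟨_, chain_mem_addChain _ _ _ 0⟩) hb
    obtain ⟨y, hy⟩ := PIso.mem_dom.mp hmem
    obtain ⟨a', b', q, hab', h1, -⟩ := mem_addChain.mp hy
    obtain ⟨⟨a, ha, rfl⟩, -⟩ := mem_diag.mp hab'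
    refine ⟨a, ha, q, ?_⟩
    filter_upwards [hb, eventually_sFun_eq hM (hA'.isPsiChain huP hu) hA' h1] with n h2 h3
    rw [h2, h3]

/-- The countable family of candidate functions with parameters in `A`. -/
noncomputable def candidate {A : Submodule ℚ Γ} (i : Option (A × (ℤ →₀ ℚ))) (x : WithTop Γ) :
    WithTop Γ :=
  i.elim ⊤ (fun j => sFun j.1.1 j.2 x)

theorem isSFunction_candidate {A : Submodule ℚ Γ} (i : Option (A × (ℤ →₀ ℚ))) :
    IsSFunction (fun x : Psi Γ => candidate i (x : WithTop Γ)) := by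
  rcases i with _ | ⟨a, q⟩
  · exact Or.inl ⟨⊤, fun x => rfl⟩
  · exact isSFunction_sFun a.1 q

/-- Two germs in `Ψ` with the same cut in `A ∩ Ψ` are conjugate over `A`. -/
theorem exists_pIso_of_cut (hM : IsModelTlog Γ) {A : Submodule ℚ Γ}
    (hA : hM.logCouple.IsClosed A) (hAc : (A : Set Γ).Countable) {x y : UPow Γ}
    (hx : x ∈ hM.logCouple.germ.Psi) (hy : y ∈ hM.logCouple.germ.Psi)
    (hcut : ∀ z ∈ A.map (constHom Γ), z ∈ hM.logCouple.germ.Psi → (x < z ↔ y < z)) :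
    ∃ G, hM.logCouple.germ.PIso G ∧ Countable G ∧ diag (A.map (constHom Γ)) ≤ G ∧
      (x, y) ∈ G := by
  have hA' := isClosed_map_const hA
  have hAc' := countable_map_const hAc
  -- A point `x` of `A` is determined by its cut: `s x` is in `A` too, so `y` satisfies `x ≤ y < s
  -- x`, and `s x` is the successor of `x` in `Ψ`.
  have heq : ∀ x y, x ∈ hM.logCouple.germ.Psi → y ∈ hM.logCouple.germ.Psi →
      (∀ z ∈ A.map (constHom Γ), z ∈ hM.logCouple.germ.Psi → (x < z ↔ y < z)) →
      x ∈ A.map (constHom Γ) → x = y := by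
    intro x y hx hy hcut hxA
    have h1 : ¬ y < x := fun h => lt_irrefl _ ((hcut x hxA hx).mpr h)
    have h2 : y < hM.logCouple.germ.s x := (hcut _ (hA'.s hxA) (hM.logCouple.germ.s_mem x)).mp
      (hM.logCouple.germ.lt_s x hx)
    refine le_antisymm (not_lt.mp h1) (not_lt.mp fun h3 => ?_)
    exact absurd (hM.logCouple.germ.s_le x hx y hy h3) (not_le.mpr h2)
  by_cases hxA : x ∈ A.map (constHom Γ)
  · exact ⟨_, hA'.pIso_diag, countable_diag hAc', le_rfl,
      mem_diag.mpr ⟨hxA, heq x y hx hy hcut hxA⟩⟩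
  · have hyA : y ∉ A.map (constHom Γ) := fun h =>
      hxA (heq y x hy hx (fun z hz hz' => (hcut z hz hz').symm) h ▸ h)
    have hG := pIso_addChain_diag hA' hx hxA hy hyA hcut
    exact ⟨_, hG, countable_addChain hAc' hG, le_addChain _ _ _, chain_mem_addChain _ _ _ 0⟩

/-- Finitely many cut points and finitely many candidates suffice. -/
theorem TransfersOver.exists_finite {hM : IsModelTlog Γ} {F : Psi Γ → WithTop Γ}
    {A : Submodule ℚ Γ} (hA : hM.logCouple.IsClosed A) (hAc : (A : Set Γ).Countable)
    (hF : TransfersOver hM F A) :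
    ∃ (d : ℕ → PsiFin Γ) (N : ℕ), ∀ x : PsiFin Γ, ∃ i : Option (A × (ℤ →₀ ℚ)),
      ∀ x' : PsiFin Γ, (∀ j ≤ N, (x < d j ↔ x' < d j)) →
        onFin F x' = candidate i (x'.1 : WithTop Γ) := by
  have hcA : Countable A := hAc.to_subtype
  obtain ⟨e, he⟩ := exists_surjective_nat (Option (A × (ℤ →₀ ℚ)))
  have hne : ({x : PsiFin Γ | x.1 ∈ A} : Set (PsiFin Γ)).Nonempty :=
    ⟨⟨succFin 0, hM.logCouple.s_mem 0⟩, hA.s A.zero_mem⟩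
  have hcount : ({x : PsiFin Γ | x.1 ∈ A} : Set (PsiFin Γ)).Countable :=
    hAc.preimage Subtype.val_injective
  obtain ⟨d, hd⟩ := hcount.exists_eq_range hne
  refine ⟨d, ?_⟩
  -- If every `N` fails, `u N` is a point on whose cell modulo `d 0, …, d N` each candidate is wrong
  -- somewhere. Some candidate `i` is right at the germ of `u`; then `u' N` is a point of that cell
  -- where `i` is wrong.
  by_contra hcon
  push Not at hcon
  choose u hu using hcon
  obtain ⟨i, hi⟩ : ∃ i, ∀ᶠ n in (hyperfilter ℕ : Filter ℕ),
      onFin F (u n) = candidate (A := A) i ((u n).1 : WithTop Γ) := by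
    rcases hF.eventually_eq hA hAc u with h | ⟨a, ha, q, h⟩
    · exact ⟨none, h⟩
    · exact ⟨some (⟨a, ha⟩, q), h⟩
  choose u' hu'1 hu'2 using fun n => hu n i
  have hP : ∀ u : ℕ → PsiFin Γ, ((fun n => (u n).1 : ℕ → Γ) : UPow Γ) ∈ hM.logCouple.germ.Psi :=
    fun u => Eventually.of_forall fun n => (u n).2
  obtain ⟨G, hG, hGc, hAG, hmem⟩ := exists_pIso_of_cut hM hA hAc (hP u) (hP u') (by
    rintro _ ⟨a, ha, rfl⟩ haP
    have haP' : a ∈ PsiFin Γ := by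
      obtain ⟨n, hn⟩ := Filter.Eventually.exists haP
      exact hn
    obtain ⟨j, hj⟩ : (⟨a, haP'⟩ : PsiFin Γ) ∈ Set.range d := hd ▸ ha
    change ((fun n => (u n).1 : ℕ → Γ) : UPow Γ) < ((fun _ => a : ℕ → Γ) : UPow Γ) ↔
      ((fun n => (u' n).1 : ℕ → Γ) : UPow Γ) < ((fun _ => a : ℕ → Γ) : UPow Γ)
    rw [Germ.coe_lt, Germ.coe_lt]
    -- The cut point `d j` is respected by `u n` and `u' n` as soon as `n ≥ j`, so the two germs
    -- have the same cut in `A ∩ Ψ`.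
    refine Filter.eventually_congr ?_
    filter_upwards [hyperfilter_ge j] with n hn
    have := hu'1 n j hn
    rw [hj] at this
    exact this)
  have hrel : SeqRel G (fun n => candidate i ((u n).1 : WithTop Γ))
      (fun n => candidate i ((u' n).1 : WithTop Γ)) := by
    rcases i with _ | ⟨a, q⟩
    · exact SeqRel.const_top
    · exact SeqRel.sFun hM hG hAG a.2 q (Or.inr ⟨_, _, Eventually.of_forall fun _ => rfl,
        Eventually.of_forall fun _ => rfl, hmem⟩)
  obtain ⟨n, hn⟩ := (hF G hG hGc hAG u u' _ _ hmem hrel hi).exists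
  exact hu'2 n hn

end AsymptoticCouple

/-! ### Sorting the cut points into intervals. -/

theorem mainTheorem3 {Γ : Type*} [AddCommGroup Γ] [LinearOrder Γ] [IsOrderedAddMonoid Γ]
    [Module ℚ Γ] [AsymptoticCouple Γ] (hΓ : AsymptoticCouple.IsModelTlog Γ)
    (F : AsymptoticCouple.Psi Γ → WithTop Γ) (hF : AsymptoticCouple.IsDefinable F) :
    ∃ (n : ℕ) (α : Fin (n + 1) → WithTop Γ),
      (∀ i, α i ∈ insert ⊤ (AsymptoticCouple.Psi Γ)) ∧
      StrictMono α ∧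
      α 0 = AsymptoticCouple.succ ((0 : Γ) : WithTop Γ) ∧
      α (Fin.last n) = ⊤ ∧
      ∀ k : Fin n, ∃ G : AsymptoticCouple.Psi Γ → WithTop Γ,
        AsymptoticCouple.IsSFunction G ∧
        ∀ x : AsymptoticCouple.Psi Γ,
          α k.castSucc ≤ (x : WithTop Γ) → (x : WithTop Γ) < α k.succ → F x = G x := by
  classical
  obtain ⟨A, hA, hAc, hFA⟩ := AsymptoticCouple.exists_transfersOver hΓ hF
  obtain ⟨d, N, hd⟩ := hFA.exists_finite hA hAc
  set s₀ := AsymptoticCouple.succ ((0 : Γ) : WithTop Γ) with hs₀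
  let T : Finset (WithTop Γ) :=
    insert ⊤ (insert s₀ ((Finset.range (N + 1)).image fun j => ((d j).1 : WithTop Γ)))
  have hT : ∀ z ∈ T, z ∈ insert ⊤ (AsymptoticCouple.Psi Γ) := by
    intro z hz
    simp only [T, Finset.mem_insert, Finset.mem_image] at hz
    rcases hz with rfl | rfl | ⟨j, -, rfl⟩
    · exact Or.inl rfl
    · exact Or.inr hΓ.isLeast_succ_zero.1
    · exact Or.inr (d j).2
  have htop : ⊤ ∈ T := Finset.mem_insert_self _ _
  have hs₀T : s₀ ∈ T := Finset.mem_insert_of_mem (Finset.mem_insert_self _ _)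
  obtain ⟨n, hn⟩ : ∃ n, T.card = n + 1 :=
    Nat.exists_eq_succ_of_ne_zero (Finset.card_pos.mpr ⟨⊤, htop⟩).ne'
  have hsurj : ∀ z ∈ T, ∃ i, T.orderEmbOfFin hn i = z := by
    intro z hz
    have := Finset.range_orderEmbOfFin T hn
    have h2 : z ∈ Set.range (T.orderEmbOfFin hn) := this ▸ hz
    exact h2
  refine ⟨n, T.orderEmbOfFin hn, fun i => hT _ (Finset.orderEmbOfFin_mem T hn i),
    (T.orderEmbOfFin hn).strictMono, ?_, ?_, fun k => ?_⟩
  · obtain ⟨i, hi⟩ := hsurj s₀ hs₀T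
    refine le_antisymm ?_ ?_
    · rw [← hi]
      exact (T.orderEmbOfFin hn).monotone (Fin.zero_le i)
    · rcases hT _ (Finset.orderEmbOfFin_mem T hn 0) with h | h
      · rw [h]; exact le_top
      · exact hΓ.isLeast_succ_zero.2 h
  · obtain ⟨i, hi⟩ := hsurj ⊤ htop
    rw [eq_top_iff, ← hi]
    exact (T.orderEmbOfFin hn).monotone (Fin.le_last i)
  · have hlt : T.orderEmbOfFin hn k.castSucc < T.orderEmbOfFin hn k.succ :=
      (T.orderEmbOfFin hn).strictMono (Fin.castSucc_lt_succ)
    have hP : T.orderEmbOfFin hn k.castSucc ∈ AsymptoticCouple.Psi Γ :=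
      (hT _ (Finset.orderEmbOfFin_mem T hn _)).resolve_left (hlt.trans_le le_top).ne
    -- The candidate is the one attached to the left endpoint. No `d j` with `j ≤ N` lies strictly
    -- inside the interval, so all its points are in the cell of that endpoint.
    obtain ⟨x, hx, hxk⟩ := AsymptoticCouple.exists_coe_of_mem_Psi hP
    obtain ⟨i, hi⟩ := hd ⟨x, hx⟩
    refine ⟨_, AsymptoticCouple.isSFunction_candidate i, fun x' h1 h2 => ?_⟩
    obtain ⟨y, hy, hyx⟩ := AsymptoticCouple.exists_coe_of_mem_Psi x'.2
    have hx' : x' = ⟨(y : WithTop Γ), hy⟩ := Subtype.ext hyx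
    subst hx'
    refine hi ⟨y, hy⟩ fun j hj => ?_
    change x < (d j).1 ↔ y < (d j).1
    rw [hxk] at h1
    have h1' : x ≤ y := WithTop.coe_le_coe.mp h1
    refine ⟨fun h => ?_, fun h => h1'.trans_lt h⟩
    obtain ⟨l, hl⟩ := hsurj ((d j).1 : WithTop Γ) (Finset.mem_insert_of_mem
      (Finset.mem_insert_of_mem (Finset.mem_image.mpr
        ⟨j, Finset.mem_range.mpr (Nat.lt_succ_of_le hj), rfl⟩)))
    have h3 : T.orderEmbOfFin hn k.castSucc < T.orderEmbOfFin hn l := by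
      rw [hl, hxk]; exact_mod_cast h
    have h4 : k.succ ≤ l := Fin.castSucc_lt_iff_succ_le.mp
      ((T.orderEmbOfFin hn).lt_iff_lt.mp h3)
    have h5 := h2.trans_le ((T.orderEmbOfFin hn).monotone h4)
    rw [hl] at h5
    exact WithTop.coe_lt_coe.mp h5
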